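/- Let $m+k=n$, $k_B,T>0$, let $A\in\mathbb R^{n\times n}$ be symmetric positive definite and $\Gamma\in\mathbb R^{n\times n}$ symmetric positive semidefinite. Consider on $[0,\infty)$ the linearized Langevin dynamics with unit masses $$\dot x=v,\qquad \dot v=-Ax-\Gamma v+f(t),$$ where $f=\dot W$ is the Gaussian white noise with $\langle f(t)f(t')^T\rangle=2k_BT\,\Gamma\,\delta(t-t')$, i.e. $W$ is a continuous $n$-dimensional Wiener process with $W(0)=0$ and covariance $\langle W(s)W(t)^T\rangle=2k_BT\min(s,t)\,\Gamma$. Let $\Phi\in\mathbb R^{n\times m}$ and $\Psi\in\mathbb R^{n\times k}$ satisfy $\Phi^T\Psi=0$, $\Phi^T\Phi=I$, $\Psi^T\Psi=I$, and write $x=\Phi q+\Psi\xi$, $v=\Phi p+\Psi\eta$. Put $A_{11}=\Phi^TA\Phi$, $A_{12}=\Phi^TA\Psi$, $A_{21}=\Psi^TA\Phi$, $A_{22}=\Psi^TA\Psi$, define $\Gamma_{11},\Gamma_{12},\Gamma_{21},\Gamma_{22}$ from $\Gamma$ in the same way, let $f_1=\Phi^Tf$, $f_2=\Psi^Tf$,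 and set $$G=\begin{bmatrix}0&-I\\A_{22}&\Gamma_{22}\end{bmatrix},\qquad \theta(t)=[A_{12},\Gamma_{12}]\,e^{-Gt}\begin{bmatrix}A_{22}^{-1}&0\\0&-I\end{bmatrix}\begin{bmatrix}A_{21}\\\Gamma_{21}\end{bmatrix}\quad(t\ge0),$$ $$F_{\mathrm{eff}}(q)=-A_{11}q+A_{12}A_{22}^{-1}A_{21}q,\qquad \widehat\xi=\xi+A_{22}^{-1}A_{21}q,$$ $$\widehat f(t)=f_1(t)-[A_{12},\Gamma_{12}]\int_0^te^{-G(t-s)}\begin{bmatrix}0\\f_2(s)\end{bmatrix}ds-[A_{12},\Gamma_{12}]\,e^{-Gt}\begin{bmatrix}\widehat\xi(0)\\\eta(0)\end{bmatrix}.$$ (1) For every solution, almost surely $(q,p)$ satisfies the generalized Langevin equation $$\dot q=p,\qquad \dot p=F_{\mathrm{eff}}(q)-\Gamma_{11}p-\int_0^t\theta(t-\tau)\,p(\tau)\,d\tau+\widehat f(t)\qquad(t\ge0),$$ where the second equation, which contains white noise, is understood in time-integrated form. (2) Suppose in addition that $(x(0),v(0))$ is independent of $W$ and distributed according to the equilibrium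 density $\propto\exp\!\big(-\tfrac1{k_BT}(\tfrac12x^TAx+\tfrac12|v|^2)\big)$. Then $\widehat f$, as a generalized process on the time axis $(0,\infty)$, is Gaussian, has mean zero, is stationary (its joint laws are invariant under time shifts by every $h\ge0$), and satisfies $$\big\langle\widehat f(t)\,\widehat f(t')^T\big\rangle=2k_BT\,\Gamma_{11}\,\delta(t-t')+k_BT\,\theta(|t-t'|),$$ that is, for all $\varphi,\psi\in C_c^\infty((0,\infty);\mathbb R^m)$, $$\mathbb E\big[\widehat f(\varphi)\,\widehat f(\psi)\big]=2k_BT\int_0^\infty\varphi(t)^T\Gamma_{11}\psi(t)\,dt+k_BT\int_0^\infty\!\!\int_0^\infty\varphi(t)^T\theta(|t-t'|)\,\psi(t')\,dt'\,dt.$$ -/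

import Mathlib

open MeasureTheory ProbabilityTheory Set
open scoped Matrix NNReal

noncomputable section

namespace GLE

/-- `W` is a Wiener process (started at `0`) with covariance matrix `S`, i.e.
`⟨W(s) W(t)ᵀ⟩ = min(s, t) S`, on the time axis `[0, ∞)`. Its derivative in the sense of
distributions is the Gaussian white noise `f` with `⟨f(t) f(t')ᵀ⟩ = S δ(t - t')`. -/
structure IsWienerProcess {Ω : Type*} [MeasurableSpace Ω] (P : Measure Ω) {n : ℕ}
    (S : Matrix (Fin n) (Fin n) ℝ) (W : ℝ → Ω → Fin n → ℝ) : Prop where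
  gaussian : IsGaussianProcess (fun t : ℝ≥0 => W t) P
  mean : ∀ t, 0 ≤ t → ∀ i, ∫ ω, W t ω i ∂P = 0
  covariance : ∀ s t, 0 ≤ s → 0 ≤ t → ∀ i j,
    cov[fun ω => W s ω i, fun ω => W t ω j; P] = min s t * S i j
  continuous : ∀ᵐ ω ∂P, ContinuousOn (fun t => W t ω) (Ici 0)

/-- `(x, v)` solves the linear Langevin dynamics `ẋ = v`, `v̇ = -A x - Γ v + f(t)` on `[0, ∞)`,
where `f` is the white noise `dW/dt`. The noise is additive, so the stochastic differential
equation is understood path by path, in integrated form. -/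
structure IsLangevinSolution {Ω : Type*} [MeasurableSpace Ω] (P : Measure Ω) {n : ℕ}
    (A Γ : Matrix (Fin n) (Fin n) ℝ) (W x v : ℝ → Ω → Fin n → ℝ) : Prop where
  continuous_x : ∀ᵐ ω ∂P, ContinuousOn (fun t => x t ω) (Ici 0)
  continuous_v : ∀ᵐ ω ∂P, ContinuousOn (fun t => v t ω) (Ici 0)
  position : ∀ᵐ ω ∂P, ∀ t, 0 ≤ t → x t ω = x 0 ω + ∫ s in (0 : ℝ)..t, v s ω
  velocity : ∀ᵐ ω ∂P, ∀ t, 0 ≤ t →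
    v t ω = v 0 ω + (∫ s in (0 : ℝ)..t, (-(A *ᵥ x s ω) - Γ *ᵥ v s ω)) + W t ω

/-- The equilibrium (Gibbs) probability measure with density proportional to `exp (-H / (k_B T))`,
`H(x, v) = ½ xᵀ A x + ½ |v|²`. -/
def gibbsMeasure {n : ℕ} (A : Matrix (Fin n) (Fin n) ℝ) (kBT : ℝ) :
    Measure ((Fin n → ℝ) × (Fin n → ℝ)) :=
  (volume : Measure ((Fin n → ℝ) × (Fin n → ℝ))).tilted
    (fun z => -((z.1 ⬝ᵥ (A *ᵥ z.1)) / 2 + (z.2 ⬝ᵥ z.2) / 2) / kBT)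

/-- The Wiener (Paley–Wiener) integral `∫₀ᵗ K(s) dw(s)` of a continuously differentiable
deterministic matrix function `K` along a continuous path `w`, given by integration by parts:
`K(t) w(t) - K(0) w(0) - ∫₀ᵗ K'(s) w(s) ds`. -/
def wienerIntegral {ι κ : Type*} [Fintype ι] [Fintype κ] (K : ℝ → Matrix κ ι ℝ)
    (w : ℝ → ι → ℝ) (t : ℝ) : κ → ℝ :=
  K t *ᵥ w t - K 0 *ᵥ w 0 - ∫ s in (0 : ℝ)..t, deriv (fun r => K r *ᵥ w s) s

section Blocks

variable {n m k : ℕ} (A Γ : Matrix (Fin n) (Fin n) ℝ)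
  (Φ : Matrix (Fin n) (Fin m) ℝ) (Ψ : Matrix (Fin n) (Fin k) ℝ)

/-- `G = [0, -I; A₂₂, Γ₂₂]` with `A₂₂ = Ψᵀ A Ψ`, `Γ₂₂ = Ψᵀ Γ Ψ`. -/
def G : Matrix (Fin k ⊕ Fin k) (Fin k ⊕ Fin k) ℝ :=
  Matrix.fromBlocks 0 (-1) (Ψᵀ * A * Ψ) (Ψᵀ * Γ * Ψ)

/-- The row block `[A₁₂, Γ₁₂]` with `A₁₂ = Φᵀ A Ψ`, `Γ₁₂ = Φᵀ Γ Ψ`. -/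
def rowBlock : Matrix (Fin m) (Fin k ⊕ Fin k) ℝ :=
  Matrix.fromCols (Φᵀ * A * Ψ) (Φᵀ * Γ * Ψ)

/-- The column block `[A₂₁; Γ₂₁]` with `A₂₁ = Ψᵀ A Φ`, `Γ₂₁ = Ψᵀ Γ Φ`. -/
def colBlock : Matrix (Fin k ⊕ Fin k) (Fin m) ℝ :=
  Matrix.fromRows (Ψᵀ * A * Φ) (Ψᵀ * Γ * Φ)

/-- The matrix exponential `e^{-Gt}`. -/
def expG (t : ℝ) : Matrix (Fin k ⊕ Fin k) (Fin k ⊕ Fin k) ℝ :=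
  NormedSpace.exp (-(t • G A Γ Ψ))

/-- The memory kernel `θ(t) = [A₁₂, Γ₁₂] e^{-Gt} diag(A₂₂⁻¹, -I) [A₂₁; Γ₂₁]`. -/
def memoryKernel (t : ℝ) : Matrix (Fin m) (Fin m) ℝ :=
  rowBlock A Γ Φ Ψ * expG A Γ Ψ t
    * Matrix.fromBlocks (Ψᵀ * A * Ψ)⁻¹ 0 0 (-1 : Matrix (Fin k) (Fin k) ℝ)
    * colBlock A Γ Φ Ψ

/-- The effective force `F_eff(q) = -A₁₁ q + A₁₂ A₂₂⁻¹ A₂₁ q`. -/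
def effectiveForce (q : Fin m → ℝ) : Fin m → ℝ :=
  -((Φᵀ * A * Φ) *ᵥ q) + ((Φᵀ * A * Ψ) * (Ψᵀ * A * Ψ)⁻¹ * (Ψᵀ * A * Φ)) *ᵥ q

/-- The function-valued part of the noise of the reduced equation,
`-[A₁₂, Γ₁₂] ∫₀ᵗ e^{-G(t-s)} [0; f₂(s)] ds - [A₁₂, Γ₁₂] e^{-Gt} [ξ̂(0); η(0)]`,
where `f₂ = Ψᵀ f` is the derivative of `Ψᵀ w` and `ξ̂(0) = ξ(0) + A₂₂⁻¹ A₂₁ q(0)`. -/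
def coloredNoise (w : ℝ → Fin n → ℝ) (q₀ : Fin m → ℝ) (ξ₀ η₀ : Fin k → ℝ) (t : ℝ) :
    Fin m → ℝ :=
  -(rowBlock A Γ Φ Ψ *ᵥ wienerIntegral (fun s => expG A Γ Ψ (t - s))
      (fun s => Sum.elim (0 : Fin k → ℝ) (Ψᵀ *ᵥ w s)) t)
    - rowBlock A Γ Φ Ψ *ᵥ (expG A Γ Ψ t
      *ᵥ Sum.elim (ξ₀ + ((Ψᵀ * A * Ψ)⁻¹ * (Ψᵀ * A * Φ)) *ᵥ q₀) η₀)

/-- The time integral `∫₀ᵗ f̂(s) ds` of the noise `f̂` of the reduced equation: the white noise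
`f₁ = Φᵀ f` integrates to `Φᵀ w`, and the remaining part of `f̂` is a function of time. -/
def noisePrimitive (w : ℝ → Fin n → ℝ) (q₀ : Fin m → ℝ) (ξ₀ η₀ : Fin k → ℝ) (t : ℝ) :
    Fin m → ℝ :=
  Φᵀ *ᵥ w t + ∫ s in (0 : ℝ)..t, coloredNoise A Γ Φ Ψ w q₀ ξ₀ η₀ s

end Blocks

/-- Smooth `ℝᵐ`-valued test functions with compact support in the open half-line `(0, ∞)`. -/
def TestFun (m : ℕ) : Type :=
  {φ : ℝ → Fin m → ℝ // ContDiff ℝ (⊤ : ℕ∞) φ ∧ HasCompactSupport φ ∧ tsupport φ ⊆ Ioi 0}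

/-- The translate `t ↦ φ(t - h)` of a test function by `h ≥ 0`. -/
def TestFun.shift {m : ℕ} (h : ℝ≥0) (φ : TestFun m) : TestFun m :=
  ⟨fun t => φ.1 (t - h), by
    obtain ⟨φ, h1, h2, h3⟩ := φ
    have e : (fun t : ℝ => φ (t - h)) = φ ∘ (Homeomorph.subRight (h : ℝ)) := rfl
    refine ⟨h1.comp (by fun_prop), ?_, ?_⟩
    · rw [e]; exact h2.comp_homeomorph _
    · rw [e]
      intro t ht
      have h4 : t - h ∈ tsupport φ := by
        have := tsupport_comp_subset_preimage φ (Homeomorph.subRight (h : ℝ)).continuous ht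
        exact this
      have h5 : 0 < t - (h : ℝ) := h3 h4
      have h6 : (0 : ℝ) ≤ h := h.2
      exact mem_Ioi.2 (by linarith)⟩

/-- The derivative, in the sense of distributions on `(0, ∞)`, of a path `w`, paired with `φ`. -/
def distribDeriv {m : ℕ} (w : ℝ → Fin m → ℝ) (φ : TestFun m) : ℝ :=
  -∫ t in Ioi (0 : ℝ), deriv φ.1 t ⬝ᵥ w t

end GLE

end

/-!
The unresolved state `Z = (ξ̂, η)` solves the linear equation
`Z' = -G Z + diag(A₂₂⁻¹, -I) [A₂₁; Γ₂₁] p + (0, f₂)`. Since the noise is additive, everything about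
it can be done path by path. Duhamel's formula splits `Z` into the response to the resolved velocity
`p`, which carries the memory kernel, and the orthogonal dynamics, which starts from `Z(0)`, is driven
by `f₂` alone and is observed as the coloured noise (`memory_eq`, `coloredNoise_eq`). Inserting
this into the equation for `p` gives the generalized Langevin equation
(`generalized_langevin_path`).

For the law of the reduced noise, transposition moves the orthogonal dynamics onto the test function:
with the adjoint state `Y' = Gᵀ Y - [A₁₂, Γ₁₂]ᵀ φ` that vanishes at late times, and
`g = Φ φ - (0, Ψᵀ)ᵀ Y`, integration by parts shows `f̂(φ) = -∫ g' · W - Y(0) · Z(0)`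
(`distribDeriv_noisePrimitive`). The first term is a Wiener integral. It is the almost sure limit of
Riemann sums `∑ g(tᵢ) · (W(tᵢ₊₁) - W(tᵢ))`, which are Gaussian with variances converging to
`∫ g · S g`, where `S = 2 k_B T Γ` (`IsWienerProcess.hasLaw_add_integral`). The second term is
Gaussian with covariance determined by the Gibbs measure (`hasLaw_gibbsMeasure_linear`), and it is
independent of the first. Hence all linear combinations of values of `f̂` are centred Gaussian
(`hasLaw_noise_combination`), so that `f̂` is a centred Gaussian process determined by its
covariance.

It remains to compute the covariance, which is deterministic: the equilibrium covariance
`diag(A₂₂⁻¹, I)` of `Z(0)` satisfies the Lyapunov equation for `G` with the noise covariance as its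
right-hand side (`G_lyapunov`), and differentiating `Y · diag(A₂₂⁻¹, I) Y` along the adjoint
equation cancels the terms quadratic in `Y` and leaves `2 Γ₁₁ δ + θ`
(`fluctuation_dissipation`, `noiseCov_eq`). This form depends on time differences only
(`noiseCov_shift`), which is stationarity.
-/

open MeasureTheory ProbabilityTheory Set
open scoped Matrix NNReal

noncomputable section

namespace GLE

/-! ### Linear differential equations with constant coefficients -/

section LinearODE

variable {ι : Type*} [Fintype ι] [DecidableEq ι]

-- the norm serves only to differentiate the matrix exponential; the topology does not depend on it
attribute [local instance] Matrix.linftyOpNormedRing Matrix.linftyOpNormedAlgebra in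
theorem hasDerivAt_exp_smul_mulVec (N : Matrix ι ι ℝ) {u : ℝ → ι → ℝ} {u' : ι → ℝ} {s : ℝ}
    (hu : HasDerivAt u u' s) :
    HasDerivAt (fun r => NormedSpace.exp (r • N) *ᵥ u r)
      (NormedSpace.exp (s • N) *ᵥ (N *ᵥ u s + u')) s := by
  have h1 := hasDerivAt_exp_smul_const (𝕂 := ℝ) N s
  have h2 : HasDerivAt (fun r => NormedSpace.exp (r • N)) (NormedSpace.exp (s • N) * N) s := h1
  rw [hasDerivAt_pi] at hu ⊢
  intro i
  have h3 : ∀ j, HasDerivAt (fun r => NormedSpace.exp (r • N) i j)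
      ((NormedSpace.exp (s • N) * N) i j) s := fun j => by
    let e : Matrix ι ι ℝ →ₗ[ℝ] ℝ :=
      { toFun := fun A => A i j, map_add' := fun _ _ => rfl, map_smul' := fun _ _ => rfl }
    exact (LinearMap.toContinuousLinearMap e).hasFDerivAt.comp_hasDerivAt s h2
  have h4 := HasDerivAt.fun_sum (u := Finset.univ) fun j _ => (h3 j).mul (hu j)
  refine h4.congr_deriv ?_
  rw [Matrix.mulVec_add, Matrix.mulVec_mulVec]
  simp [Matrix.mulVec, dotProduct, Finset.sum_add_distrib]

theorem exp_add_smul (N : Matrix ι ι ℝ) (s t : ℝ) :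
    NormedSpace.exp ((s + t) • N) = NormedSpace.exp (s • N) * NormedSpace.exp (t • N) := by
  rw [add_smul, Matrix.exp_add_of_commute]
  exact ((Commute.refl N).smul_left s).smul_right t

theorem continuous_exp_smul (N : Matrix ι ι ℝ) :
    Continuous fun s : ℝ => NormedSpace.exp (s • N) := by
  refine continuous_matrix fun i j => ?_
  have h1 : Continuous fun s : ℝ => NormedSpace.exp (s • N) *ᵥ (Pi.single j (1 : ℝ)) :=
    continuous_iff_continuousAt.2 fun s => by
      have h0 := hasDerivAt_exp_smul_mulVec N (hasDerivAt_const s (Pi.single j (1 : ℝ) : ι → ℝ))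
      exact h0.continuousAt
  exact ((continuous_apply i).comp h1).congr fun s => by simp

theorem continuous_exp_smul_mulVec (N : Matrix ι ι ℝ) {c : ℝ → ℝ} (hc : Continuous c)
    {b : ℝ → ι → ℝ} (hb : Continuous b) :
    Continuous fun s => NormedSpace.exp (c s • N) *ᵥ b s :=
  ((continuous_exp_smul N).comp hc).matrix_mulVec hb

/-- Duhamel's formula on the interval with end points `t₀` and `t`. -/
theorem duhamel_of_continuousOn (N : Matrix ι ι ℝ) {y b : ℝ → ι → ℝ} (hb : Continuous b)
    {t₀ t : ℝ} (hyc : ContinuousOn y (uIcc t₀ t))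
    (hy : ∀ s ∈ Ioo (min t₀ t) (max t₀ t), HasDerivAt y (N *ᵥ y s + b s) s) :
    y t = NormedSpace.exp ((t - t₀) • N) *ᵥ y t₀
      + ∫ s in t₀..t, NormedSpace.exp ((t - s) • N) *ᵥ b s := by
  have h1 : ∀ s ∈ Ioo (min t₀ t) (max t₀ t),
      HasDerivAt (fun s => NormedSpace.exp ((t - s) • N) *ᵥ y s)
      (NormedSpace.exp ((t - s) • N) *ᵥ b s) s := fun s hs => by
    have h2 := hasDerivAt_exp_smul_mulVec (-N) (hy s hs)
    have h3 : HasDerivAt (fun s => NormedSpace.exp (t • N) *ᵥ (NormedSpace.exp (s • -N) *ᵥ y s))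
      (NormedSpace.exp (t • N) *ᵥ
        (NormedSpace.exp (s • -N) *ᵥ (-N *ᵥ y s + (N *ᵥ y s + b s)))) s :=
      (Matrix.mulVecLin (NormedSpace.exp (t • N))).toContinuousLinearMap.hasFDerivAt.comp_hasDerivAt
        s h2
    have h4 : ∀ s (z : ι → ℝ), NormedSpace.exp (t • N) *ᵥ (NormedSpace.exp (s • -N) *ᵥ z)
        = NormedSpace.exp ((t - s) • N) *ᵥ z := fun s z => by
      rw [Matrix.mulVec_mulVec, smul_neg, ← neg_smul, ← exp_add_smul, sub_eq_add_neg]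
    simp only [h4, Matrix.neg_mulVec, neg_add_cancel_left] at h3
    exact h3
  have hexp : Continuous fun s => NormedSpace.exp ((t - s) • N) :=
    (continuous_exp_smul N).comp (continuous_const.sub continuous_id)
  have h5 := intervalIntegral.integral_eq_sub_of_hasDeriv_right (a := t₀) (b := t)
    ((continuous_fst.matrix_mulVec continuous_snd).comp_continuousOn
      (hexp.continuousOn.prodMk hyc))
    (fun s hs => (h1 s hs).hasDerivWithinAt)
    ((continuous_exp_smul_mulVec N (continuous_const.sub continuous_id) hb).intervalIntegrable _ _)
  rw [h5]
  simp

theorem duhamel (N : Matrix ι ι ℝ) {y b : ℝ → ι → ℝ} (hb : Continuous b)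
    (hy : ∀ t, HasDerivAt y (N *ᵥ y t + b t) t) (t₀ t : ℝ) :
    y t = NormedSpace.exp ((t - t₀) • N) *ᵥ y t₀
      + ∫ s in t₀..t, NormedSpace.exp ((t - s) • N) *ᵥ b s :=
  duhamel_of_continuousOn N hb (fun s _ => (hy s).continuousAt.continuousWithinAt) fun s _ => hy s

theorem exists_solution (N : Matrix ι ι ℝ) {b : ℝ → ι → ℝ} (hb : Continuous b) (t₀ : ℝ)
    (y₀ : ι → ℝ) :
    ∃ y : ℝ → ι → ℝ, y t₀ = y₀ ∧ ∀ t, HasDerivAt y (N *ᵥ y t + b t) t := by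
  have hc := continuous_exp_smul_mulVec N (c := fun s => t₀ - s) (by fun_prop) hb
  let F : ℝ → ι → ℝ := fun t => y₀ + ∫ s in t₀..t, NormedSpace.exp ((t₀ - s) • N) *ᵥ b s
  have hF : ∀ t, HasDerivAt F (NormedSpace.exp ((t₀ - t) • N) *ᵥ b t) t := fun t =>
    (intervalIntegral.integral_hasDerivAt_right (hc.intervalIntegrable _ _)
      (hc.stronglyMeasurableAtFilter _ _) hc.continuousAt).const_add _
  refine ⟨fun t => NormedSpace.exp ((t - t₀) • N) *ᵥ F t, by simp [F], fun t => ?_⟩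
  have h2 : HasDerivAt (fun t => F (t + t₀)) (NormedSpace.exp ((t₀ - t) • N) *ᵥ b t) (t - t₀) := by
    have h := hF t
    rw [← sub_add_cancel t t₀] at h
    have := HasDerivAt.comp_add_const (t - t₀) t₀ h
    simpa using this
  have h3 := hasDerivAt_exp_smul_mulVec N h2
  have h4 := HasDerivAt.comp_sub_const t t₀ h3
  simp only [sub_add_cancel] at h4
  refine h4.congr_deriv ?_
  have h5 : NormedSpace.exp ((t - t₀) • N) * N = N * NormedSpace.exp ((t - t₀) • N) :=
    (Commute.exp_left ((Commute.refl N).smul_left (t - t₀))).eq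
  rw [Matrix.mulVec_add, Matrix.mulVec_mulVec, Matrix.mulVec_mulVec, Matrix.mulVec_mulVec,
    ← exp_add_smul, h5]
  simp

end LinearODE

/-! ### Calculus of vector-valued functions -/

section Calculus

variable {ι κ : Type*} [Fintype ι] [Fintype κ]

theorem hasDerivAt_dotProduct {u v : ℝ → ι → ℝ} {u' v' : ι → ℝ} {s : ℝ}
    (hu : HasDerivAt u u' s) (hv : HasDerivAt v v' s) :
    HasDerivAt (fun t => u t ⬝ᵥ v t) (u' ⬝ᵥ v s + u s ⬝ᵥ v') s := by
  rw [hasDerivAt_pi] at hu hv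
  refine (HasDerivAt.fun_sum fun i _ => (hu i).mul (hv i)).congr_deriv ?_
  simp [dotProduct, Finset.sum_add_distrib]

theorem hasDerivAt_mulVec (B : Matrix κ ι ℝ) {u : ℝ → ι → ℝ} {u' : ι → ℝ} {s : ℝ}
    (hu : HasDerivAt u u' s) : HasDerivAt (fun t => B *ᵥ u t) (B *ᵥ u') s :=
  (Matrix.mulVecLin B).toContinuousLinearMap.hasFDerivAt.comp_hasDerivAt s hu

theorem mulVec_intervalIntegral (B : Matrix κ ι ℝ) {u : ℝ → ι → ℝ} (hu : Continuous u)
    (a b : ℝ) : B *ᵥ (∫ t in a..b, u t) = ∫ t in a..b, B *ᵥ u t :=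
  ((Matrix.mulVecLin B).toContinuousLinearMap.intervalIntegral_comp_comm
    (hu.intervalIntegrable a b)).symm

theorem dotProduct_intervalIntegral (c : ι → ℝ) {u : ℝ → ι → ℝ} (hu : Continuous u)
    (a b : ℝ) : c ⬝ᵥ (∫ t in a..b, u t) = ∫ t in a..b, c ⬝ᵥ u t :=
  ((LinearMap.toContinuousLinearMap (dotProductBilin ℝ ℝ c)).intervalIntegral_comp_comm
    (hu.intervalIntegrable a b)).symm

theorem transpose_mulVec_dotProduct (B : Matrix κ ι ℝ) (u : κ → ℝ) (v : ι → ℝ) :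
    (Bᵀ *ᵥ u) ⬝ᵥ v = u ⬝ᵥ (B *ᵥ v) := by
  rw [Matrix.mulVec_transpose, Matrix.dotProduct_mulVec]

theorem mulVec_dotProduct (B : Matrix κ ι ℝ) (u : ι → ℝ) (v : κ → ℝ) :
    (B *ᵥ u) ⬝ᵥ v = u ⬝ᵥ (Bᵀ *ᵥ v) := by
  rw [← transpose_mulVec_dotProduct, Matrix.transpose_transpose]

end Calculus

/-! ### Adjoint states and the fluctuation-dissipation identity -/

section Adjoint

variable {ι κ ν : Type*} [Fintype ι] [Fintype κ] [Fintype ν]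

/-- `Y` solves the backward adjoint equation `Y' = Nᵀ Y - Rᵀ φ` with final value zero. -/
structure IsAdjointState (N : Matrix ι ι ℝ) (R : Matrix κ ι ℝ) (φ : ℝ → κ → ℝ)
    (Y : ℝ → ι → ℝ) : Prop where
  hasDerivAt : ∀ t, HasDerivAt Y (Nᵀ *ᵥ Y t - Rᵀ *ᵥ φ t) t
  vanish : ∃ M, ∀ t, M ≤ t → Y t = 0

theorem IsAdjointState.continuous {N : Matrix ι ι ℝ} {R : Matrix κ ι ℝ} {φ : ℝ → κ → ℝ}
    {Y : ℝ → ι → ℝ} (h : IsAdjointState N R φ Y) : Continuous Y :=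
  continuous_iff_continuousAt.2 fun t => (h.hasDerivAt t).continuousAt

variable [DecidableEq ι]

theorem exists_isAdjointState (N : Matrix ι ι ℝ) (R : Matrix κ ι ℝ) {φ : ℝ → κ → ℝ}
    (hφ : Continuous φ) {M : ℝ} (hM : ∀ t, M ≤ t → φ t = 0) :
    ∃ Y, IsAdjointState N R φ Y := by
  have hb : Continuous fun t => -(Rᵀ *ᵥ φ t) := (continuous_const.matrix_mulVec hφ).neg
  obtain ⟨Y, h0, hY⟩ := exists_solution Nᵀ hb M 0
  refine ⟨Y, fun t => by simpa [sub_eq_add_neg] using hY t, M, fun t ht => ?_⟩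
  rw [duhamel Nᵀ hb hY M t, h0, Matrix.mulVec_zero, zero_add]
  refine (intervalIntegral.integral_congr (g := fun _ => 0) fun s hs => ?_).trans (by simp)
  rw [uIcc_of_le ht] at hs
  simp [hM s hs.1]

/-- The deterministic core of the fluctuation-dissipation theorem. The first integral is the
contribution of the driving noise to the covariance and the boundary term that of the initial data,
whose covariance `B` satisfies the Lyapunov equation `G B + B Gᵀ = Q S Qᵀ`. Differentiating
`Y · B Z` turns the boundary term into an integral over time, in which the terms quadratic in the
adjoint states cancel by `lyapunov`; the mixed terms are converted by `cross` into the memory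
kernel. -/
theorem fluctuation_dissipation {G B D : Matrix ι ι ℝ} {R : Matrix κ ι ℝ} {Q : Matrix ι ν ℝ}
    {Φ : Matrix ν κ ℝ} {S : Matrix ν ν ℝ} (hS : Sᵀ = S) (hB : Bᵀ = B) (hD : Dᵀ = D)
    (lyapunov : G * B + B * Gᵀ = Q * S * Qᵀ)
    (cross : R * B - Φᵀ * S * Qᵀ = R * D)
    (symm : G * D = D * Gᵀ)
    {φ ψ : ℝ → κ → ℝ} (hφ : Continuous φ) (hψ : Continuous ψ)
    {Y Z : ℝ → ι → ℝ} (hY : IsAdjointState G R φ Y) (hZ : IsAdjointState G R ψ Z)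
    {M : ℝ} (hM : 0 ≤ M) (hYM : Y M = 0) (hZM : Z M = 0) :
    (∫ t in (0 : ℝ)..M, (Φ *ᵥ φ t - Qᵀ *ᵥ Y t) ⬝ᵥ (S *ᵥ (Φ *ᵥ ψ t - Qᵀ *ᵥ Z t)))
        + Y 0 ⬝ᵥ (B *ᵥ Z 0)
      = (∫ t in (0 : ℝ)..M, φ t ⬝ᵥ ((Φᵀ * S * Φ) *ᵥ ψ t))
        + ∫ t in (0 : ℝ)..M, ∫ s in (0 : ℝ)..M,
            φ t ⬝ᵥ ((R * NormedSpace.exp (-(|t - s| • G)) * D * Rᵀ) *ᵥ ψ s) := by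
  have hYc := hY.continuous
  have hZc := hZ.continuous
  have hb : Continuous fun t => (D * Rᵀ) *ᵥ ψ t := continuous_const.matrix_mulVec hψ
  -- `X` is the response to the past of `ψ`; it replaces an exchange of the order of integration
  obtain ⟨X, hX0, hX⟩ := exists_solution (-G) hb 0 0
  have hXc : Continuous X := continuous_iff_continuousAt.2 fun t => (hX t).continuousAt
  -- the convolution with the kernel is the sum of a forward and a backward state
  have hker : ∀ t ∈ uIcc 0 M, (∫ s in (0 : ℝ)..M,
      φ t ⬝ᵥ ((R * NormedSpace.exp (-(|t - s| • G)) * D * Rᵀ) *ᵥ ψ s))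
      = φ t ⬝ᵥ (R *ᵥ (D *ᵥ Z t + X t)) := fun t ht => by
    rw [uIcc_of_le hM] at ht
    have h1 : D *ᵥ Z t = ∫ s in t..M, NormedSpace.exp (-(|t - s| • G)) *ᵥ ((D * Rᵀ) *ᵥ ψ s) := by
      have h2 : ∀ t, HasDerivAt (fun t => D *ᵥ Z t) (G *ᵥ (D *ᵥ Z t) + -((D * Rᵀ) *ᵥ ψ t)) t :=
        fun t => by
          refine (hasDerivAt_mulVec D (hZ.hasDerivAt t)).congr_deriv ?_
          simp only [Matrix.mulVec_sub, Matrix.mulVec_mulVec, symm]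
          abel
      rw [duhamel G hb.neg h2 M t, hZM, Matrix.mulVec_zero, Matrix.mulVec_zero, zero_add,
        intervalIntegral.integral_symm, ← intervalIntegral.integral_neg]
      refine intervalIntegral.integral_congr fun s hs => ?_
      rw [uIcc_of_le ht.2] at hs
      simp only [abs_of_nonpos (sub_nonpos.2 hs.1), neg_smul, neg_neg, Pi.neg_apply,
        Matrix.mulVec_neg]
    have h3 : X t = ∫ s in (0 : ℝ)..t,
        NormedSpace.exp (-(|t - s| • G)) *ᵥ ((D * Rᵀ) *ᵥ ψ s) := by
      rw [duhamel (-G) hb hX 0 t, hX0, Matrix.mulVec_zero, zero_add]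
      refine intervalIntegral.integral_congr fun s hs => ?_
      rw [uIcc_of_le ht.1] at hs
      simp only [abs_of_nonneg (sub_nonneg.2 hs.2), smul_neg]
    have hc : Continuous fun s => NormedSpace.exp (-(|t - s| • G)) *ᵥ ((D * Rᵀ) *ᵥ ψ s) := by
      simp only [← smul_neg]
      exact continuous_exp_smul_mulVec _ (by fun_prop) hb
    rw [h1, h3, add_comm, intervalIntegral.integral_add_adjacent_intervals
      (hc.intervalIntegrable _ _) (hc.intervalIntegrable _ _),
      mulVec_intervalIntegral _ hc, dotProduct_intervalIntegral _
        (continuous_const.matrix_mulVec hc)]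
    simp only [Matrix.mulVec_mulVec, Matrix.mul_assoc]
  rw [intervalIntegral.integral_congr hker]
  have hder : ∀ t, HasDerivAt (fun t => Y t ⬝ᵥ (B *ᵥ Z t + X t))
      ((Gᵀ *ᵥ Y t - Rᵀ *ᵥ φ t) ⬝ᵥ (B *ᵥ Z t + X t)
        + Y t ⬝ᵥ (B *ᵥ (Gᵀ *ᵥ Z t - Rᵀ *ᵥ ψ t) + (-G *ᵥ X t + (D * Rᵀ) *ᵥ ψ t))) t := fun t =>
    hasDerivAt_dotProduct (hY.hasDerivAt t)
      ((hasDerivAt_mulVec B (hZ.hasDerivAt t)).add (hX t))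
  have hFTC := intervalIntegral.integral_eq_sub_of_hasDerivAt (a := 0) (b := M)
    (fun t _ => hder t) (Continuous.intervalIntegrable (by fun_prop) _ _)
  simp only [hYM, hX0, zero_dotProduct, add_zero, zero_sub] at hFTC
  have cross' : B * Rᵀ - Q * S * Φ = D * Rᵀ := by
    have := congrArg Matrix.transpose cross
    simpa [Matrix.transpose_mul, hB, hS, hD, Matrix.mul_assoc] using this
  rw [← neg_eq_iff_eq_neg.2 hFTC, ← sub_eq_add_neg, ← intervalIntegral.integral_sub,
    ← intervalIntegral.integral_add]
  · refine intervalIntegral.integral_congr fun t _ => ?_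
    have e1 := congrArg (fun A => Y t ⬝ᵥ (A *ᵥ Z t)) lyapunov
    have e2 := congrArg (fun A => φ t ⬝ᵥ (A *ᵥ Z t)) cross
    have e3 := congrArg (fun A => Y t ⬝ᵥ (A *ᵥ ψ t)) cross'
    simp only [Matrix.sub_mulVec, Matrix.add_mulVec, Matrix.mulVec_sub, Matrix.mulVec_add,
      Matrix.neg_mulVec, transpose_mulVec_dotProduct, mulVec_dotProduct Φ, dotProduct_sub,
      sub_dotProduct, dotProduct_add, dotProduct_neg, Matrix.mulVec_mulVec,
      Matrix.mul_assoc] at e1 e2 e3 ⊢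
    linarith
  all_goals exact Continuous.intervalIntegrable (by fun_prop) _ _

end Adjoint

/-! ### Families of Gaussian random variables -/

section GaussianFamilies

open Filter Topology

variable {Ω : Type*} [MeasurableSpace Ω] {P : Measure Ω} {κ : Type*} [Fintype κ]

theorem integral_sq_eq_of_hasLaw_gaussianReal [IsProbabilityMeasure P] {X : Ω → ℝ} {v : ℝ≥0}
    (h : HasLaw X (gaussianReal 0 v) P) : ∫ ω, X ω ^ 2 ∂P = v := by
  have h1 : ∫ ω, X ω ∂P = 0 := by rw [h.integral_eq, integral_id_gaussianReal]
  rw [← variance_of_integral_eq_zero h.aemeasurable h1, h.variance_eq, variance_id_gaussianReal]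

theorem memLp_two_of_hasLaw_gaussianReal {X : Ω → ℝ} {μ : ℝ} {v : ℝ≥0}
    (h : HasLaw X (gaussianReal μ v) P) : MemLp X 2 P :=
  (HasLaw.hasGaussianLaw h).memLp_two

theorem strongDual_pi_apply (L : StrongDual ℝ (κ → ℝ)) :
    ∃ c : κ → ℝ, ∀ y, L y = ∑ i, c i * y i := by
  classical
  refine ⟨fun i => L (Pi.single i 1), fun y => ?_⟩
  conv_lhs => rw [← Finset.univ_sum_single y, map_sum]
  refine Finset.sum_congr rfl fun i _ => ?_
  rw [show (Pi.single i (y i) : κ → ℝ) = y i • Pi.single i 1 by simp [← Pi.single_smul],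
    map_smul, smul_eq_mul, mul_comm]

/-- A finite family of real random variables all of whose linear combinations are centred Gaussian
is jointly Gaussian. -/
theorem hasGaussianLaw_of_linear_combinations {X : κ → Ω → ℝ}
    (hm : ∀ i, AEMeasurable (X i) P)
    (h : ∀ c : κ → ℝ, ∃ v : ℝ≥0, HasLaw (fun ω => ∑ i, c i * X i ω) (gaussianReal 0 v) P) :
    HasGaussianLaw (fun ω i => X i ω) P where
  isGaussian_map := by
    refine isGaussian_of_map_eq_gaussianReal fun L => ?_
    obtain ⟨c, hc⟩ := strongDual_pi_apply L
    obtain ⟨v, hv⟩ := h c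
    refine ⟨0, v, ?_⟩
    rw [AEMeasurable.map_map_of_aemeasurable (by fun_prop) (aemeasurable_pi_lambda _ hm),
      ← hv.map_eq]
    congr 1
    ext ω
    exact hc _

/-- The joint law of a finite family of random variables is determined by the laws of its linear
combinations. -/
theorem identDistrib_of_linear_combinations [IsProbabilityMeasure P] {X X' : κ → Ω → ℝ}
    (hm : ∀ i, AEMeasurable (X i) P) (hm' : ∀ i, AEMeasurable (X' i) P)
    (h : ∀ c : κ → ℝ, ∃ μ : Measure ℝ, HasLaw (fun ω => ∑ i, c i * X i ω) μ P ∧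
      HasLaw (fun ω => ∑ i, c i * X' i ω) μ P) :
    IdentDistrib (fun ω i => X i ω) (fun ω i => X' i ω) P P where
  aemeasurable_fst := aemeasurable_pi_lambda _ hm
  aemeasurable_snd := aemeasurable_pi_lambda _ hm'
  map_eq := by
    refine Measure.ext_of_charFunDual ?_
    ext L
    obtain ⟨c, hc⟩ := strongDual_pi_apply L
    obtain ⟨μ, h1, h2⟩ := h c
    rw [charFunDual_eq_charFun_map_one, charFunDual_eq_charFun_map_one,
      AEMeasurable.map_map_of_aemeasurable (by fun_prop) (aemeasurable_pi_lambda _ hm),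
      AEMeasurable.map_map_of_aemeasurable (by fun_prop) (aemeasurable_pi_lambda _ hm')]
    have e1 : (L ∘ fun ω i => X i ω) = fun ω => ∑ i, c i * X i ω := by ext ω; exact hc _
    have e2 : (L ∘ fun ω i => X' i ω) = fun ω => ∑ i, c i * X' i ω := by ext ω; exact hc _
    rw [e1, e2, h1.map_eq, h2.map_eq]

/-- Almost sure limits of centred Gaussian variables with convergent variances are centred
Gaussian. -/
theorem hasLaw_gaussianReal_of_tendsto [IsProbabilityMeasure P] {X : ℕ → Ω → ℝ} {Y : Ω → ℝ}
    {v : ℕ → ℝ≥0} {w : ℝ≥0} (hX : ∀ N, HasLaw (X N) (gaussianReal 0 (v N)) P)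
    (hv : Tendsto v atTop (𝓝 w)) (hY : ∀ᵐ ω ∂P, Tendsto (fun N => X N ω) atTop (𝓝 (Y ω))) :
    HasLaw Y (gaussianReal 0 w) P := by
  have hYm : AEMeasurable Y P :=
    aemeasurable_of_tendsto_metrizable_ae' (fun N => (hX N).aemeasurable) hY
  have := Measure.isProbabilityMeasure_map hYm
  refine ⟨hYm, Measure.ext_of_charFun ?_⟩
  ext t
  have h1 : ∀ {Z : Ω → ℝ}, AEMeasurable Z P →
      charFun (P.map Z) t = ∫ ω, Complex.exp (t * Z ω * Complex.I) ∂P := fun hZ => by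
    rw [charFun_apply_real, integral_map hZ (by fun_prop)]
  have h2 : Tendsto (fun N => charFun (P.map (X N)) t) atTop (𝓝 (charFun (P.map Y) t)) := by
    rw [h1 hYm]
    simp only [fun N => h1 (hX N).aemeasurable]
    refine tendsto_integral_of_dominated_convergence (fun _ => 1) (fun N => ?_)
      (integrable_const _) (fun N => ?_) ?_
    · have := (hX N).aemeasurable
      exact AEMeasurable.aestronglyMeasurable (by fun_prop)
    · refine .of_forall fun ω => ?_
      rw [← Complex.ofReal_mul, Complex.norm_exp_ofReal_mul_I]
    · filter_upwards [hY] with ω hω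
      have hc : Continuous fun z : ℝ => Complex.exp (t * z * Complex.I) := by fun_prop
      exact (hc.tendsto _).comp hω
  have h3 : Tendsto (fun N => charFun (P.map (X N)) t) atTop
      (𝓝 (charFun (gaussianReal 0 w) t)) := by
    simp only [fun N => (hX N).map_eq, charFun_gaussianReal]
    have hc : Continuous fun z : ℝ≥0 =>
        Complex.exp (t * (0 : ℝ) * Complex.I - (z : ℝ) * t ^ 2 / 2) := by fun_prop
    exact (hc.tendsto _).comp hv
  exact tendsto_nhds_unique h2 h3

end GaussianFamilies

/-! ### Riemann sums and increments of the Wiener process -/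

section RiemannSums

open Filter Topology

/-- Freezing the second argument of `h` at an arbitrary tag in each interval of the uniform
partition of `[0, M]` gives in the limit the integral of `h` along the diagonal. -/
theorem tendsto_sum_integral_tagged {h : ℝ → ℝ → ℝ} (hc : Continuous fun z : ℝ × ℝ => h z.1 z.2)
    {M : ℝ} (hM : 0 ≤ M) {τ : ℕ → ℕ → ℝ}
    (hτ : ∀ N i, i * (M / (N + 1)) ≤ τ N i ∧ τ N i ≤ (i + 1 : ℕ) * (M / (N + 1))) :
    Tendsto (fun N : ℕ => ∑ i ∈ Finset.range (N + 1),
      ∫ u in (i * (M / (N + 1)))..((i + 1 : ℕ) * (M / (N + 1))), h u (τ N i)) atTop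
      (𝓝 (∫ u in (0 : ℝ)..M, h u u)) := by
  rw [Metric.tendsto_atTop]
  intro ε hε
  have hUC := (isCompact_Icc.prod isCompact_Icc :
    IsCompact (Icc 0 M ×ˢ Icc 0 M)).uniformContinuousOn_of_continuous hc.continuousOn
  rw [Metric.uniformContinuousOn_iff] at hUC
  obtain ⟨δ, hδ, hUC⟩ := hUC (ε / (M + 1)) (by positivity)
  obtain ⟨N₀, hN₀⟩ := exists_nat_gt (M / δ)
  refine ⟨N₀, fun N hN => ?_⟩
  set d : ℝ := M / (N + 1) with hd
  have hN1 : (0 : ℝ) < N + 1 := by positivity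
  have hd0 : 0 ≤ d := by positivity
  have hNd : (N + 1 : ℝ) * d = M := by rw [hd]; field_simp
  have hdδ : d < δ := by
    rw [hd, div_lt_iff₀ hN1]
    rw [div_lt_iff₀ hδ] at hN₀
    have : (N₀ : ℝ) ≤ N := by exact_mod_cast hN
    nlinarith
  have hdiag : Continuous fun u => h u u := hc.comp (continuous_id.prodMk continuous_id)
  have htag : ∀ s, Continuous fun u => h u s := fun s =>
    hc.comp (continuous_id.prodMk continuous_const)
  have hsum : ∫ u in (0 : ℝ)..M, h u u = ∑ i ∈ Finset.range (N + 1),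
      ∫ u in (i * d)..((i + 1 : ℕ) * d), h u u := by
    rw [intervalIntegral.sum_integral_adjacent_intervals (a := fun i : ℕ => (i : ℝ) * d)
      (fun i _ => hdiag.intervalIntegrable _ _)]
    push_cast
    rw [zero_mul, hNd]
  rw [Real.dist_eq, hsum, ← Finset.sum_sub_distrib]
  have hbound : ∀ i ∈ Finset.range (N + 1),
      |(∫ u in (i * d)..((i + 1 : ℕ) * d), h u (τ N i))
        - ∫ u in (i * d)..((i + 1 : ℕ) * d), h u u| ≤ ε / (M + 1) * d := fun i hi => by
    have hiN : (i : ℝ) + 1 ≤ N + 1 := by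
      have := Finset.mem_range.1 hi
      exact_mod_cast this
    have hle : (i : ℝ) * d ≤ (i + 1 : ℕ) * d := by push_cast; nlinarith
    rw [← intervalIntegral.integral_sub ((htag _).intervalIntegrable _ _)
      (hdiag.intervalIntegrable _ _), ← Real.norm_eq_abs]
    have key := intervalIntegral.norm_integral_le_of_norm_le_const
      (a := (i : ℝ) * d) (b := (i + 1 : ℕ) * d) (C := ε / (M + 1))
      (f := fun u => h u (τ N i) - h u u) fun u hu => by
        rw [uIoc_of_le hle] at hu
        obtain ⟨h1, h2⟩ := hτ N i
        rw [← hd] at h1 h2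
        have h3 : ((i + 1 : ℕ) : ℝ) * d ≤ M := by
          rw [← hNd]; push_cast; exact mul_le_mul_of_nonneg_right hiN hd0
        have h4 : 0 ≤ (i : ℝ) * d := by positivity
        have h5 : ((i + 1 : ℕ) : ℝ) * d = i * d + d := by push_cast; ring
        refine (hUC (u, τ N i) ⟨⟨by linarith [hu.1], by linarith [hu.2]⟩,
          ⟨by linarith, by linarith⟩⟩ (u, u) ⟨⟨by linarith [hu.1], by linarith [hu.2]⟩,
          ⟨by linarith [hu.1], by linarith [hu.2]⟩⟩ ?_).le
        rw [Prod.dist_eq, dist_self, max_lt_iff]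
        refine ⟨hδ, lt_of_le_of_lt ?_ hdδ⟩
        rw [Real.dist_eq, abs_le]
        constructor <;> linarith [hu.1, hu.2]
    refine key.trans_eq ?_
    rw [abs_of_nonneg (by linarith)]
    push_cast
    ring
  calc |∑ i ∈ Finset.range (N + 1), ((∫ u in (i * d)..((i + 1 : ℕ) * d), h u (τ N i))
        - ∫ u in (i * d)..((i + 1 : ℕ) * d), h u u)|
      ≤ ∑ i ∈ Finset.range (N + 1), ε / (M + 1) * d :=
        (Finset.abs_sum_le_sum_abs _ _).trans (Finset.sum_le_sum hbound)
    _ = ε / (M + 1) * M := by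
        rw [Finset.sum_const, Finset.card_range, nsmul_eq_mul, ← hNd]; push_cast; ring
    _ < ε := by
        rw [div_mul_eq_mul_div, div_lt_iff₀ (by positivity)]
        nlinarith

end RiemannSums

section WienerIntegral

open Filter Topology

variable {Ω : Type*} [MeasurableSpace Ω] {P : Measure Ω} {n : ℕ} {S : Matrix (Fin n) (Fin n) ℝ}
  {W : ℝ → Ω → Fin n → ℝ}

theorem IsWienerProcess.hasGaussianLaw (hW : IsWienerProcess P S W) {t : ℝ} (ht : 0 ≤ t) :
    HasGaussianLaw (W t) P :=
  hW.gaussian.hasGaussianLaw_eval ⟨t, ht⟩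

theorem IsWienerProcess.memLp (hW : IsWienerProcess P S W) {t : ℝ} (ht : 0 ≤ t) (i : Fin n) :
    MemLp (fun ω => W t ω i) 2 P :=
  ((hW.hasGaussianLaw ht).map_fun (ContinuousLinearMap.proj i)).memLp_two

theorem IsWienerProcess.ae_zero [IsProbabilityMeasure P] (hW : IsWienerProcess P S W) :
    ∀ᵐ ω ∂P, W 0 ω = 0 := by
  have h : ∀ i, ∀ᵐ ω ∂P, W 0 ω i = 0 := fun i => by
    have h1 := hW.covariance 0 0 le_rfl le_rfl i i
    rw [min_self, zero_mul, covariance_self (hW.memLp le_rfl i).aemeasurable] at h1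
    have h2 := ae_eq_integral_of_variance_eq_zero (hW.memLp le_rfl i) h1
    rw [hW.mean 0 le_rfl i] at h2
    exact h2
  filter_upwards [ae_all_iff.2 h] with ω hω
  exact funext hω

theorem IsWienerProcess.covariance_increments [IsProbabilityMeasure P]
    (hW : IsWienerProcess P S W) {d : ℝ} (hd : 0 ≤ d) (i j : ℕ) (a b : Fin n) :
    cov[fun ω => W ((i + 1 : ℕ) * d) ω a - W (i * d) ω a,
      fun ω => W ((j + 1 : ℕ) * d) ω b - W (j * d) ω b; P] = if i = j then d * S a b else 0 := by
  have h0 : ∀ i : ℕ, 0 ≤ (i : ℝ) * d := fun i => by positivity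
  rw [covariance_fun_sub_fun_sub (hW.memLp (h0 _) _) (hW.memLp (h0 _) _) (hW.memLp (h0 _) _)
    (hW.memLp (h0 _) _)]
  simp only [hW.covariance _ _ (h0 _) (h0 _), ← min_mul_of_nonneg _ _ hd, ← Nat.cast_min]
  rcases lt_trichotomy i j with h | h | h
  · rw [if_neg h.ne, min_eq_left (by omega), min_eq_left (by omega), min_eq_left (by omega),
      min_eq_left (by omega)]
    ring
  · subst h
    rw [if_pos rfl, min_eq_left (by omega), min_eq_right (by omega), min_eq_left (by omega),
      min_eq_left (by omega)]
    push_cast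
    ring
  · rw [if_neg h.ne', min_eq_right (by omega), min_eq_right (by omega), min_eq_right (by omega),
      min_eq_right (by omega)]
    ring

/-- A Riemann sum of `∫ g · dW` is centred Gaussian; its variance is the corresponding Riemann sum
of `∫ g · S g`. -/
theorem IsWienerProcess.hasLaw_sum_increments [IsProbabilityMeasure P]
    (hW : IsWienerProcess P S W) {d : ℝ} (hd : 0 ≤ d) (N : ℕ) (g : ℕ → Fin n → ℝ) :
    0 ≤ ∑ i ∈ Finset.range N, d * (g i ⬝ᵥ (S *ᵥ g i)) ∧
    HasLaw (fun ω => ∑ i ∈ Finset.range N, g i ⬝ᵥ (W ((i + 1 : ℕ) * d) ω - W (i * d) ω))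
      (gaussianReal 0 (∑ i ∈ Finset.range N, d * (g i ⬝ᵥ (S *ᵥ g i))).toNNReal) P := by
  have h0 : ∀ i : ℕ, 0 ≤ (i : ℝ) * d := fun i => by positivity
  have hincr := hW.gaussian.hasGaussianLaw_increments
    (t := fun i : Fin (N + 1) => (⟨(i : ℕ) * d, h0 i⟩ : ℝ≥0))
  let L : (Fin N → Fin n → ℝ) →ₗ[ℝ] ℝ :=
    { toFun := fun y => ∑ i : Fin N, g i ⬝ᵥ y i
      map_add' := fun x y => by simp [dotProduct_add, Finset.sum_add_distrib]
      map_smul' := fun c x => by simp [Finset.mul_sum] }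
  have hL := hincr.map_fun (LinearMap.toContinuousLinearMap L)
  have e : (fun ω => ∑ i ∈ Finset.range N, g i ⬝ᵥ (W ((i + 1 : ℕ) * d) ω - W (i * d) ω))
      = fun ω => (LinearMap.toContinuousLinearMap L)
        fun i : Fin N => W ((i.succ : ℕ) * d) ω - W ((i.castSucc : ℕ) * d) ω := by
    ext ω
    simp [L, Finset.sum_range]
  have hG : HasGaussianLaw
      (fun ω => ∑ i ∈ Finset.range N, g i ⬝ᵥ (W ((i + 1 : ℕ) * d) ω - W (i * d) ω)) P := by
    rw [e]; exact hL
  have hI : ∀ i a, MemLp (fun ω => W ((i + 1 : ℕ) * d) ω a - W (i * d) ω a) 2 P := fun i a =>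
    (hW.memLp (h0 _) a).sub (hW.memLp (h0 _) a)
  have hmul : ∀ i a, MemLp (fun ω => g i a * (W ((i + 1 : ℕ) * d) ω a - W (i * d) ω a)) 2 P :=
    fun i a => (hI i a).const_mul _
  have hmean : ∫ ω, ∑ i ∈ Finset.range N, g i ⬝ᵥ (W ((i + 1 : ℕ) * d) ω - W (i * d) ω) ∂P = 0 := by
    simp only [dotProduct, Pi.sub_apply]
    rw [integral_finsetSum _ fun i _ => integrable_finsetSum _ fun a _ =>
      (hmul i a).integrable one_le_two]
    refine Finset.sum_eq_zero fun i _ => ?_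
    rw [integral_finsetSum _ fun a _ => (hmul i a).integrable one_le_two]
    refine Finset.sum_eq_zero fun a _ => ?_
    rw [integral_const_mul, integral_sub ((hW.memLp (h0 _) a).integrable one_le_two)
      ((hW.memLp (h0 _) a).integrable one_le_two), hW.mean _ (h0 _), hW.mean _ (h0 _)]
    simp
  have hvar : Var[fun ω => ∑ i ∈ Finset.range N, g i ⬝ᵥ (W ((i + 1 : ℕ) * d) ω - W (i * d) ω); P]
      = ∑ i ∈ Finset.range N, d * (g i ⬝ᵥ (S *ᵥ g i)) := by
    rw [← covariance_self hG.aemeasurable]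
    simp only [dotProduct, Pi.sub_apply]
    rw [covariance_fun_sum_fun_sum' (fun i _ => memLp_finsetSum _ fun a _ => hmul i a)
      (fun i _ => memLp_finsetSum _ fun a _ => hmul i a)]
    refine Finset.sum_congr rfl fun i hi => ?_
    have hij : ∀ j, cov[fun ω => ∑ a, g i a * (W ((i + 1 : ℕ) * d) ω a - W (i * d) ω a),
        fun ω => ∑ b, g j b * (W ((j + 1 : ℕ) * d) ω b - W (j * d) ω b); P]
        = if i = j then d * ∑ a, g i a * (S *ᵥ g i) a else 0 := fun j => by
      rw [covariance_fun_sum_fun_sum (hmul i) (hmul j)]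
      simp only [covariance_const_mul_left, covariance_const_mul_right,
        hW.covariance_increments hd]
      split_ifs with h
      · subst h
        simp only [Matrix.mulVec, dotProduct, Finset.mul_sum]
        exact Finset.sum_congr rfl fun a _ => Finset.sum_congr rfl fun b _ => by ring
      · simp
    simp only [hij, Finset.sum_ite_eq, hi, if_true]
  refine ⟨hvar ▸ variance_nonneg _ _, hG.aemeasurable, ?_⟩
  rw [hG.map_eq_gaussianReal, hmean, hvar]

end WienerIntegral

/-! ### Wiener integrals -/

section WienerLimit

open Filter Topology

variable {Ω : Type*} [MeasurableSpace Ω] {P : Measure Ω} {n : ℕ} {S : Matrix (Fin n) (Fin n) ℝ}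
  {W : ℝ → Ω → Fin n → ℝ}

theorem continuous_comp_max_zero {E : Type*} [TopologicalSpace E] {w : ℝ → E}
    (hw : ContinuousOn w (Ici 0)) : Continuous fun t => w (max t 0) := by
  rw [← continuousOn_univ]
  exact hw.comp (by fun_prop) fun t _ => le_max_right t 0

/-- Summation by parts turns Riemann sums of `∫ g · dw` into tagged Riemann sums of `-∫ g' · w`. -/
theorem tendsto_sum_increments {w : ℝ → Fin n → ℝ} (hw : ContinuousOn w (Ici 0)) (hw0 : w 0 = 0)
    {g g' : ℝ → Fin n → ℝ} (hg : ∀ t, HasDerivAt g (g' t) t) (hg' : Continuous g') {M : ℝ}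
    (hM : 0 ≤ M) (hgM : g M = 0) :
    Tendsto (fun N : ℕ => ∑ i ∈ Finset.range (N + 1),
      g (i * (M / (N + 1))) ⬝ᵥ (w ((i + 1 : ℕ) * (M / (N + 1))) - w (i * (M / (N + 1))))) atTop
      (𝓝 (-∫ t in (0 : ℝ)..M, g' t ⬝ᵥ w t)) := by
  have hwc := continuous_comp_max_zero hw
  have hT := (tendsto_sum_integral_tagged (h := fun u s => g' u ⬝ᵥ w (max s 0))
    ((hg'.comp continuous_fst).dotProduct (hwc.comp continuous_snd)) hM
    (τ := fun N i => (i + 1 : ℕ) * (M / (N + 1)))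
    fun N i => ⟨by push_cast; gcongr; linarith, le_rfl⟩).neg
  have e : ∫ t in (0 : ℝ)..M, g' t ⬝ᵥ w (max t 0) = ∫ t in (0 : ℝ)..M, g' t ⬝ᵥ w t :=
    intervalIntegral.integral_congr fun t ht => by
      rw [uIcc_of_le hM] at ht
      simp only [max_eq_left ht.1]
  rw [e] at hT
  refine hT.congr fun N => ?_
  set d : ℝ := M / (N + 1) with hd
  have hd0 : 0 ≤ d := by positivity
  have hNd : ((N + 1 : ℕ) : ℝ) * d = M := by rw [hd]; push_cast; field_simp
  have h1 : ∀ i : ℕ, ∫ u in (i * d)..((i + 1 : ℕ) * d), g' u ⬝ᵥ w (max ((i + 1 : ℕ) * d) 0)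
      = (g ((i + 1 : ℕ) * d) - g (i * d)) ⬝ᵥ w ((i + 1 : ℕ) * d) := fun i => by
    rw [max_eq_left (by positivity), ← intervalIntegral.integral_eq_sub_of_hasDerivAt
      (fun t _ => hg t) (hg'.intervalIntegrable _ _), dotProduct_comm,
      dotProduct_intervalIntegral _ hg']
    simp only [dotProduct_comm]
  have h2 := Finset.sum_range_sub (fun i : ℕ => g (i * d) ⬝ᵥ w (i * d)) (N + 1)
  rw [hNd, hgM, zero_dotProduct, Nat.cast_zero, zero_mul, hw0, dotProduct_zero, sub_zero] at h2
  rw [neg_eq_iff_add_eq_zero, Finset.sum_congr rfl fun i _ => h1 i, ← Finset.sum_add_distrib]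
  refine Eq.trans ?_ h2
  refine Finset.sum_congr rfl fun i _ => ?_
  simp only [dotProduct_sub, sub_dotProduct]
  ring

/-- The law of `z + ∫ g · dW`, where the centred Gaussian variable `z` is independent of the Wiener
process `W`: the Wiener integral is written as `-∫ g' · W` and contributes the variance
`∫ g · S g`. -/
theorem IsWienerProcess.hasLaw_add_integral [IsProbabilityMeasure P]
    (hW : IsWienerProcess P S W) {z : Ω → ℝ} {v : ℝ≥0} (hz : HasLaw z (gaussianReal 0 v) P)
    (hind : IndepFun z (fun ω (t : ℝ≥0) => W t ω) P)
    {g g' : ℝ → Fin n → ℝ} (hg : ∀ t, HasDerivAt g (g' t) t) (hg' : Continuous g') {M : ℝ}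
    (hM : 0 ≤ M) (hgM : g M = 0) :
    0 ≤ ∫ t in (0 : ℝ)..M, g t ⬝ᵥ (S *ᵥ g t) ∧
    HasLaw (fun ω => z ω - ∫ t in (0 : ℝ)..M, g' t ⬝ᵥ W t ω)
      (gaussianReal 0 (v + (∫ t in (0 : ℝ)..M, g t ⬝ᵥ (S *ᵥ g t)).toNNReal)) P := by
  have hgc : Continuous g := continuous_iff_continuousAt.2 fun t => (hg t).continuousAt
  have hd0 : ∀ N : ℕ, 0 ≤ M / (N + 1) := fun N => by positivity
  have hsum := fun N : ℕ => hW.hasLaw_sum_increments (hd0 N) (N + 1)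
    (fun i => g (i * (M / (N + 1))))
  have hvar := tendsto_sum_integral_tagged (h := fun _ s => g s ⬝ᵥ (S *ᵥ g s)) (by fun_prop) hM
    (τ := fun N i => i * (M / (N + 1))) fun N i => ⟨le_rfl, by push_cast; gcongr; linarith⟩
  have hvar' : Tendsto (fun N : ℕ => ∑ i ∈ Finset.range (N + 1), M / (N + 1) *
      (g (i * (M / (N + 1))) ⬝ᵥ (S *ᵥ g (i * (M / (N + 1)))))) atTop
      (𝓝 (∫ t in (0 : ℝ)..M, g t ⬝ᵥ (S *ᵥ g t))) := by
    refine hvar.congr fun N => Finset.sum_congr rfl fun i _ => ?_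
    rw [intervalIntegral.integral_const, smul_eq_mul]
    push_cast
    ring
  refine ⟨ge_of_tendsto' hvar' fun N => (hsum N).1, ?_⟩
  refine hasLaw_gaussianReal_of_tendsto (X := fun N ω => z ω + ∑ i ∈ Finset.range (N + 1),
      g (i * (M / (N + 1))) ⬝ᵥ (W ((i + 1 : ℕ) * (M / (N + 1))) ω - W (i * (M / (N + 1))) ω))
    (v := fun N => v + (∑ i ∈ Finset.range (N + 1), M / (N + 1) *
      (g (i * (M / (N + 1))) ⬝ᵥ (S *ᵥ g (i * (M / (N + 1)))))).toNNReal) (fun N => ?_)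
    (tendsto_const_nhds.add ((continuous_real_toNNReal.tendsto _).comp hvar')) ?_
  · refine ⟨hz.aemeasurable.add (hsum N).2.aemeasurable, ?_⟩
    have h0 : ∀ i : ℕ, 0 ≤ (i : ℝ) * (M / (N + 1)) := fun i => by positivity
    have hF : Measurable fun y : ℝ≥0 → Fin n → ℝ => ∑ i ∈ Finset.range (N + 1),
        g (i * (M / (N + 1))) ⬝ᵥ (y ⟨_, h0 (i + 1)⟩ - y ⟨_, h0 i⟩) := by
      refine Finset.measurable_sum _ fun i _ => ?_
      simp only [dotProduct]
      exact Finset.measurable_sum _ fun a _ => by fun_prop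
    have := gaussianReal_add_gaussianReal_of_indepFun (hind.comp measurable_id hF) hz.map_eq
      (hsum N).2.map_eq
    rwa [zero_add] at this
  · filter_upwards [hW.continuous, hW.ae_zero] with ω h1 h2
    simpa [sub_eq_add_neg] using (tendsto_sum_increments h1 h2 hg hg' hM hgM).const_add (z ω)

end WienerLimit

/-! ### The Gibbs measure -/

section Gibbs

variable {n : ℕ}

/-- Under the Gibbs measure every linear form is centred Gaussian; completing the square and
translation invariance of Lebesgue measure give its moment generating function. Finiteness of the
partition function is encoded in the assumption that `gibbsMeasure A β` is a probability measure. -/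
theorem hasLaw_gibbsMeasure_linear {A : Matrix (Fin n) (Fin n) ℝ} (hA : A.PosDef) {β : ℝ}
    (hβ : 0 < β) [IsProbabilityMeasure (gibbsMeasure A β)] (a b : Fin n → ℝ) :
    0 ≤ a ⬝ᵥ (A⁻¹ *ᵥ a) + b ⬝ᵥ b ∧
    HasLaw (fun z : (Fin n → ℝ) × (Fin n → ℝ) => a ⬝ᵥ z.1 + b ⬝ᵥ z.2)
      (gaussianReal 0 (β * (a ⬝ᵥ (A⁻¹ *ᵥ a) + b ⬝ᵥ b)).toNNReal) (gibbsMeasure A β) := by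
  have hAT : Aᵀ = A := by simpa [Matrix.IsHermitian] using hA.isHermitian
  have hAi : A * A⁻¹ = 1 := Matrix.mul_nonsing_inv A ((Matrix.isUnit_iff_isUnit_det _).1 hA.isUnit)
  set κ := a ⬝ᵥ (A⁻¹ *ᵥ a) + b ⬝ᵥ b with hκ
  have hκ0 : 0 ≤ κ := by
    have h1 := hA.inv.posSemidef.dotProduct_mulVec_nonneg a
    have h2 := dotProduct_self_star_nonneg b
    simp only [star_trivial] at h1 h2
    linarith
  refine ⟨hκ0, ?_⟩
  set f : (Fin n → ℝ) × (Fin n → ℝ) → ℝ :=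
    fun z => -((z.1 ⬝ᵥ (A *ᵥ z.1)) / 2 + (z.2 ⬝ᵥ z.2) / 2) / β with hf
  -- a tilted measure with a non-integrable density is zero
  have hint : Integrable (fun z => Real.exp (f z)) := by
    by_contra h
    exact IsProbabilityMeasure.ne_zero (gibbsMeasure A β) (tilted_of_not_integrable h)
  have hZ : 0 < ∫ z, Real.exp (f z) := integral_exp_pos hint
  have hXm : Measurable fun z : (Fin n → ℝ) × (Fin n → ℝ) => a ⬝ᵥ z.1 + b ⬝ᵥ z.2 :=
    Continuous.measurable (by fun_prop)
  have hmgf : mgf (fun z : (Fin n → ℝ) × (Fin n → ℝ) => a ⬝ᵥ z.1 + b ⬝ᵥ z.2) (gibbsMeasure A β)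
      = mgf id (gaussianReal 0 (β * κ).toNNReal) := by
    ext t
    rw [mgf_id_gaussianReal]
    simp only [mgf]
    rw [gibbsMeasure, integral_exp_tilted, div_eq_iff hZ.ne']
    -- completing the square: tilting by a linear form shifts the density by `β t (A⁻¹ a, b)`
    have hsq : ∀ z : (Fin n → ℝ) × (Fin n → ℝ),
        Real.exp ((f + fun z : (Fin n → ℝ) × (Fin n → ℝ) => t * (a ⬝ᵥ z.1 + b ⬝ᵥ z.2)) z)
        = Real.exp (β * κ * t ^ 2 / 2) *
          Real.exp (f (z - ((β * t) • (A⁻¹ *ᵥ a), (β * t) • b))) := fun z => by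
      have e1 : z.1 ⬝ᵥ (A *ᵥ (A⁻¹ *ᵥ a)) = a ⬝ᵥ z.1 := by
        rw [Matrix.mulVec_mulVec, hAi, Matrix.one_mulVec, dotProduct_comm]
      have e2 : (A⁻¹ *ᵥ a) ⬝ᵥ (A *ᵥ z.1) = a ⬝ᵥ z.1 := by
        rw [dotProduct_comm, mulVec_dotProduct, hAT, e1]
      have e3 : (A⁻¹ *ᵥ a) ⬝ᵥ (A *ᵥ (A⁻¹ *ᵥ a)) = a ⬝ᵥ (A⁻¹ *ᵥ a) := by
        rw [Matrix.mulVec_mulVec, hAi, Matrix.one_mulVec, dotProduct_comm]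
      rw [← Real.exp_add]
      congr 1
      simp only [hf, hκ, Pi.add_apply, Prod.fst_sub, Prod.snd_sub, Matrix.mulVec_sub,
        Matrix.mulVec_smul, dotProduct_sub, sub_dotProduct, dotProduct_smul, smul_dotProduct,
        smul_eq_mul, e1, e2, e3, dotProduct_comm z.2 b]
      field_simp
      ring
    have : (volume : Measure ((Fin n → ℝ) × (Fin n → ℝ))).IsAddRightInvariant := by
      rw [Measure.volume_eq_prod]; infer_instance
    rw [integral_congr_ae (.of_forall hsq), integral_const_mul, integral_sub_right_eq_self (fun z => Real.exp (f z))]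
    congr 2
    rw [Real.coe_toNNReal _ (mul_nonneg hβ.le hκ0)]
    ring
  refine ⟨hXm.aemeasurable, ?_⟩
  rw [← Measure.map_id (μ := gaussianReal 0 (β * κ).toNNReal)]
  refine Measure.ext_of_complexMGF_eq hXm.aemeasurable aemeasurable_id ?_
  have hset : integrableExpSet (fun z : (Fin n → ℝ) × (Fin n → ℝ) => a ⬝ᵥ z.1 + b ⬝ᵥ z.2)
      (gibbsMeasure A β) = univ := by
    rw [integrableExpSet_eq_of_mgf hmgf]
    exact eq_univ_of_forall fun t => integrable_exp_mul_gaussianReal t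
  have := eqOn_complexMGF_of_mgf hmgf
  rw [hset, interior_univ] at this
  ext z
  exact this (mem_univ _)

end Gibbs

/-! ### Linear functionals of the initial data and of the driving path -/

section LinearFunctionals

variable {Ω : Type*} [MeasurableSpace Ω] {P : Measure Ω} {n : ℕ}
  {A S : Matrix (Fin n) (Fin n) ℝ} {W : ℝ → Ω → Fin n → ℝ} {J : Type*} [Fintype J]

theorem sum_smul_dotProduct_mulVec (B : Matrix (Fin n) (Fin n) ℝ) (c : J → ℝ)
    (u : J → Fin n → ℝ) :
    (∑ i, c i • u i) ⬝ᵥ (B *ᵥ ∑ j, c j • u j)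
      = ∑ i, ∑ j, c i * c j * (u i ⬝ᵥ (B *ᵥ u j)) := by
  rw [Matrix.mulVec_sum, sum_dotProduct]
  refine Finset.sum_congr rfl fun i _ => ?_
  rw [dotProduct_sum]
  refine Finset.sum_congr rfl fun j _ => ?_
  rw [Matrix.mulVec_smul, smul_dotProduct, dotProduct_smul, smul_eq_mul, smul_eq_mul]
  ring

/-- Linear functionals of equilibrium initial data and of an independent Wiener process are jointly
centred Gaussian, with the covariance given by the Itô isometry and the Gibbs measure. -/
theorem IsWienerProcess.hasLaw_linear_combination [IsProbabilityMeasure P]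
    (hW : IsWienerProcess P S W) (hA : A.PosDef) {β : ℝ} (hβ : 0 < β)
    {x₀ v₀ : Ω → Fin n → ℝ} (hlaw : HasLaw (fun ω => (x₀ ω, v₀ ω)) (gibbsMeasure A β) P)
    (hind : IndepFun (fun ω => (x₀ ω, v₀ ω)) (fun ω (t : ℝ≥0) => W t ω) P)
    {g g' : J → ℝ → Fin n → ℝ} (hg : ∀ j t, HasDerivAt (g j) (g' j t) t)
    (hg' : ∀ j, Continuous (g' j)) {M : ℝ} (hM : 0 ≤ M) (hgM : ∀ j, g j M = 0)
    (a b : J → Fin n → ℝ) {X : J → Ω → ℝ}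
    (hX : ∀ j, ∀ᵐ ω ∂P, X j ω = a j ⬝ᵥ x₀ ω + b j ⬝ᵥ v₀ ω - ∫ t in (0 : ℝ)..M, g' j t ⬝ᵥ W t ω)
    {C : J → J → ℝ}
    (hC : ∀ i j, C i j = (∫ t in (0 : ℝ)..M, g i t ⬝ᵥ (S *ᵥ g j t))
      + β * (a i ⬝ᵥ (A⁻¹ *ᵥ a j) + b i ⬝ᵥ b j)) (c : J → ℝ) :
    0 ≤ ∑ i, ∑ j, c i * c j * C i j ∧
    HasLaw (fun ω => ∑ j, c j * X j ω)
      (gaussianReal 0 (∑ i, ∑ j, c i * c j * C i j).toNNReal) P := by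
  have hgc : ∀ j, Continuous (g j) := fun j =>
    continuous_iff_continuousAt.2 fun t => (hg j t).continuousAt
  have hprob : IsProbabilityMeasure (gibbsMeasure A β) := by
    rw [← hlaw.map_eq]; exact Measure.isProbabilityMeasure_map hlaw.aemeasurable
  obtain ⟨hκ, hz⟩ := hasLaw_gibbsMeasure_linear hA hβ (∑ j, c j • a j) (∑ j, c j • b j)
  have hzΩ := hz.comp hlaw
  have hlin : Measurable fun z : (Fin n → ℝ) × (Fin n → ℝ) =>
      (∑ j, c j • a j) ⬝ᵥ z.1 + (∑ j, c j • b j) ⬝ᵥ z.2 := Continuous.measurable (by fun_prop)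
  obtain ⟨hV, hL⟩ := hW.hasLaw_add_integral hzΩ (hind.comp hlin measurable_id)
    (g := fun t => ∑ j, c j • g j t) (g' := fun t => ∑ j, c j • g' j t)
    (fun t => HasDerivAt.fun_sum fun j _ => (hg j t).const_smul (c j))
    (continuous_finsetSum _ fun j _ => (hg' j).const_smul (c j)) hM (by simp [hgM])
  have hsum : (∫ t in (0 : ℝ)..M, (∑ j, c j • g j t) ⬝ᵥ (S *ᵥ ∑ j, c j • g j t))
      + β * ((∑ j, c j • a j) ⬝ᵥ (A⁻¹ *ᵥ ∑ j, c j • a j)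
        + (∑ j, c j • b j) ⬝ᵥ ∑ j, c j • b j) = ∑ i, ∑ j, c i * c j * C i j := by
    have hb := sum_smul_dotProduct_mulVec 1 c b
    simp only [Matrix.one_mulVec] at hb
    rw [hb, sum_smul_dotProduct_mulVec]
    simp only [sum_smul_dotProduct_mulVec, hC]
    rw [intervalIntegral.integral_finsetSum fun i _ =>
      Continuous.intervalIntegrable (by fun_prop) _ _]
    rw [← Finset.sum_add_distrib, Finset.mul_sum, ← Finset.sum_add_distrib]
    refine Finset.sum_congr rfl fun i _ => ?_
    rw [intervalIntegral.integral_finsetSum fun j _ =>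
      Continuous.intervalIntegrable (by fun_prop) _ _]
    rw [← Finset.sum_add_distrib, Finset.mul_sum, ← Finset.sum_add_distrib]
    refine Finset.sum_congr rfl fun j _ => ?_
    rw [intervalIntegral.integral_const_mul]
    ring
  refine ⟨hsum ▸ add_nonneg hV (mul_nonneg hβ.le hκ), ?_⟩
  rw [← hsum, Real.toNNReal_add hV (mul_nonneg hβ.le hκ), add_comm]
  refine hL.congr ?_
  filter_upwards [ae_all_iff.2 hX, hW.continuous] with ω h1 h2
  have hint : ∀ j, IntervalIntegrable (fun t => g' j t ⬝ᵥ W t ω) volume 0 M := fun j => by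
    refine ContinuousOn.intervalIntegrable ?_
    rw [uIcc_of_le hM]
    exact (continuous_fst.dotProduct continuous_snd).comp_continuousOn
      ((hg' j).continuousOn.prodMk (h2.mono Icc_subset_Ici_self))
  simp only [h1, Function.comp_apply, sum_dotProduct, smul_dotProduct, smul_eq_mul]
  rw [intervalIntegral.integral_finsetSum fun j _ => (hint j).const_mul _]
  simp only [intervalIntegral.integral_const_mul, mul_sub, mul_add, Finset.sum_sub_distrib,
    Finset.sum_add_distrib]

end LinearFunctionals

/-! ### Block matrix identities -/

section BlockAlgebra

variable {n m k : ℕ} (A Γ : Matrix (Fin n) (Fin n) ℝ)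
  (Φ : Matrix (Fin n) (Fin m) ℝ) (Ψ : Matrix (Fin n) (Fin k) ℝ)

/-- The equilibrium covariance, in units of `k_B T`, of the unresolved state `(ξ̂, η)`. -/
def stateCov : Matrix (Fin k ⊕ Fin k) (Fin k ⊕ Fin k) ℝ :=
  Matrix.fromBlocks (Ψᵀ * A * Ψ)⁻¹ 0 0 1

/-- The middle factor `diag(A₂₂⁻¹, -I)` of the memory kernel. -/
def kernelSign : Matrix (Fin k ⊕ Fin k) (Fin k ⊕ Fin k) ℝ :=
  Matrix.fromBlocks (Ψᵀ * A * Ψ)⁻¹ 0 0 (-1)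

/-- The map `v ↦ (0, Ψᵀ v)` from velocities (or noise) to the unresolved state. -/
def velocityCol : Matrix (Fin k ⊕ Fin k) (Fin n) ℝ := Matrix.fromRows 0 Ψᵀ

/-- The map `x ↦ (A₂₂⁻¹ Ψᵀ A x, 0)`; its first component is `ξ̂ = ξ + A₂₂⁻¹ A₂₁ q`. -/
def positionCol : Matrix (Fin k ⊕ Fin k) (Fin n) ℝ :=
  Matrix.fromRows ((Ψᵀ * A * Ψ)⁻¹ * (Ψᵀ * A)) 0

variable {A Γ Φ Ψ}

theorem resolution_of_identity (hdim : m + k = n) (hΦΨ : Φᵀ * Ψ = 0) (hΦ : Φᵀ * Φ = 1)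
    (hΨ : Ψᵀ * Ψ = 1) : Φ * Φᵀ + Ψ * Ψᵀ = 1 := by
  have hΨΦ : Ψᵀ * Φ = 0 := by simpa using congrArg Matrix.transpose hΦΨ
  rw [← Matrix.fromCols_mul_fromRows,
    Matrix.fromCols_mul_fromRows_eq_one_comm ((finCongr hdim.symm).trans finSumFinEquiv.symm),
    Matrix.fromRows_mul_fromCols, hΦΨ, hΦ, hΨ, hΨΦ, Matrix.fromBlocks_one]

theorem isUnit_det_block (hA : A.PosDef) (hΨ : Ψᵀ * Ψ = 1) : IsUnit (Ψᵀ * A * Ψ).det := by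
  have hinj : Function.Injective Ψ.mulVec := fun u v h => by
    have := congrArg (Ψᵀ.mulVec) h
    simpa [Matrix.mulVec_mulVec, hΨ] using this
  have := (hA.conjTranspose_mul_mul_same hinj).isUnit
  rw [Matrix.conjTranspose_eq_transpose_of_trivial] at this
  exact (Matrix.isUnit_iff_isUnit_det _).1 this

theorem transpose_block (hA : Aᵀ = A) : (Ψᵀ * A * Ψ)ᵀ = Ψᵀ * A * Ψ := by
  simp [Matrix.transpose_mul, hA, Matrix.mul_assoc]

theorem transpose_stateCov (hA : Aᵀ = A) : (stateCov A Ψ)ᵀ = stateCov A Ψ := by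
  simp [stateCov, Matrix.fromBlocks_transpose, Matrix.transpose_nonsing_inv, transpose_block hA]

theorem transpose_kernelSign (hA : Aᵀ = A) : (kernelSign A Ψ)ᵀ = kernelSign A Ψ := by
  simp [kernelSign, Matrix.fromBlocks_transpose, Matrix.transpose_nonsing_inv, transpose_block hA]

theorem transpose_rowBlock (hA : Aᵀ = A) (hΓ : Γᵀ = Γ) :
    (rowBlock A Γ Φ Ψ)ᵀ = colBlock A Γ Φ Ψ := by
  simp [rowBlock, colBlock, Matrix.transpose_fromCols, Matrix.transpose_mul, hA, hΓ,
    Matrix.mul_assoc]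

theorem transpose_velocityCol : (velocityCol Ψ)ᵀ = Matrix.fromCols 0 Ψ := by
  simp [velocityCol, Matrix.transpose_fromRows]

theorem transpose_positionCol (hA : Aᵀ = A) :
    (positionCol A Ψ)ᵀ = Matrix.fromCols (A * Ψ * (Ψᵀ * A * Ψ)⁻¹) 0 := by
  simp [positionCol, Matrix.transpose_fromRows, Matrix.transpose_mul,
    Matrix.transpose_nonsing_inv, transpose_block hA, hA]

/-- The Lyapunov equation: the covariance `stateCov` is invariant under the orthogonal dynamics. -/
theorem G_lyapunov (hA : Aᵀ = A) (hΓ : Γᵀ = Γ) (hdet : IsUnit (Ψᵀ * A * Ψ).det) :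
    G A Γ Ψ * stateCov A Ψ + stateCov A Ψ * (G A Γ Ψ)ᵀ
      = velocityCol Ψ * ((2 : ℝ) • Γ) * (velocityCol Ψ)ᵀ := by
  rw [transpose_velocityCol, G, stateCov, velocityCol, Matrix.fromBlocks_transpose,
    transpose_block hA, transpose_block hΓ, Matrix.fromBlocks_multiply, Matrix.fromBlocks_multiply,
    Matrix.fromRows_mul, Matrix.fromRows_mul_fromCols, Matrix.fromBlocks_add]
  simp [Matrix.mul_nonsing_inv _ hdet, Matrix.nonsing_inv_mul _ hdet, two_smul,
    Matrix.mul_add, Matrix.add_mul]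

theorem rowBlock_cross :
    rowBlock A Γ Φ Ψ * stateCov A Ψ - Φᵀ * ((2 : ℝ) • Γ) * (velocityCol Ψ)ᵀ
      = rowBlock A Γ Φ Ψ * kernelSign A Ψ := by
  rw [transpose_velocityCol, rowBlock, stateCov, kernelSign, Matrix.fromCols_mul_fromBlocks,
    Matrix.fromCols_mul_fromBlocks, Matrix.mul_fromCols]
  ext i (j | j)
  · simp
  · simp [two_mul]

theorem G_symm (hA : Aᵀ = A) (hΓ : Γᵀ = Γ) (hdet : IsUnit (Ψᵀ * A * Ψ).det) :
    G A Γ Ψ * kernelSign A Ψ = kernelSign A Ψ * (G A Γ Ψ)ᵀ := by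
  rw [G, kernelSign, Matrix.fromBlocks_transpose,
    transpose_block hA, transpose_block hΓ, Matrix.fromBlocks_multiply, Matrix.fromBlocks_multiply]
  simp [Matrix.mul_nonsing_inv _ hdet, Matrix.nonsing_inv_mul _ hdet]

/-- `stateCov` is the covariance of `(ξ̂, η)` when `x` and `v` are independent with covariances
`A⁻¹` and `1`. -/
theorem stateCov_eq (hA : Aᵀ = A) (hAdet : IsUnit A.det) (hdet : IsUnit (Ψᵀ * A * Ψ).det)
    (hΨ : Ψᵀ * Ψ = 1) :
    positionCol A Ψ * A⁻¹ * (positionCol A Ψ)ᵀ + velocityCol Ψ * (velocityCol Ψ)ᵀ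
      = stateCov A Ψ := by
  have h : (Ψᵀ * A * Ψ)⁻¹ * (Ψᵀ * A) * A⁻¹ * (A * Ψ * (Ψᵀ * A * Ψ)⁻¹) = (Ψᵀ * A * Ψ)⁻¹ := by
    calc _ = (Ψᵀ * A * Ψ)⁻¹ * (Ψᵀ * (A * A⁻¹) * A * Ψ) * (Ψᵀ * A * Ψ)⁻¹ := by
          simp only [Matrix.mul_assoc]
      _ = _ := by
          rw [Matrix.mul_nonsing_inv _ hAdet, Matrix.mul_one, Matrix.nonsing_inv_mul _ hdet,
            Matrix.one_mul]
  rw [transpose_velocityCol, transpose_positionCol hA, velocityCol, positionCol, stateCov,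
    Matrix.fromRows_mul, Matrix.fromRows_mul_fromCols, Matrix.fromRows_mul_fromCols,
    Matrix.fromBlocks_add, h, hΨ]
  simp

theorem G_mul_positionCol (hdet : IsUnit (Ψᵀ * A * Ψ).det) :
    G A Γ Ψ * positionCol A Ψ = velocityCol Ψ * A := by
  rw [G, positionCol, velocityCol, Matrix.fromBlocks_mul_fromRows, Matrix.fromRows_mul,
    ← Matrix.mul_assoc (Ψᵀ * A * Ψ), Matrix.mul_nonsing_inv _ hdet]
  simp

/-- The resolved velocity drives the unresolved state through `diag(A₂₂⁻¹, -I) [A₂₁; Γ₂₁]`. -/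
theorem positionCol_sub (hdet : IsUnit (Ψᵀ * A * Ψ).det) (hid : Φ * Φᵀ + Ψ * Ψᵀ = 1) :
    positionCol A Ψ - velocityCol Ψ * Γ + G A Γ Ψ * velocityCol Ψ
      = kernelSign A Ψ * colBlock A Γ Φ Ψ * Φᵀ := by
  have hid' : Φ * Φᵀ = 1 - Ψ * Ψᵀ := eq_sub_of_add_eq hid
  rw [G, positionCol, velocityCol, kernelSign, colBlock, Matrix.fromBlocks_mul_fromRows,
    Matrix.fromBlocks_mul_fromRows, Matrix.fromRows_mul, Matrix.fromRows_mul]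
  have h1 : (Ψᵀ * A * Ψ)⁻¹ * (Ψᵀ * A * Φ) * Φᵀ = (Ψᵀ * A * Ψ)⁻¹ * (Ψᵀ * A) - Ψᵀ := by
    calc _ = (Ψᵀ * A * Ψ)⁻¹ * (Ψᵀ * A * (Φ * Φᵀ)) := by simp only [Matrix.mul_assoc]
      _ = (Ψᵀ * A * Ψ)⁻¹ * (Ψᵀ * A) - (Ψᵀ * A * Ψ)⁻¹ * (Ψᵀ * A * Ψ) * Ψᵀ := by
          rw [hid', Matrix.mul_sub, Matrix.mul_sub]; simp only [Matrix.mul_assoc, Matrix.mul_one]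
      _ = _ := by rw [Matrix.nonsing_inv_mul _ hdet, Matrix.one_mul]
  have h2 : Ψᵀ * Γ * Φ * Φᵀ = Ψᵀ * Γ - Ψᵀ * Γ * Ψ * Ψᵀ := by
    rw [Matrix.mul_assoc, hid', Matrix.mul_sub, Matrix.mul_one, ← Matrix.mul_assoc]
  ext (i | i) j
  · simp [h1, ← sub_eq_add_neg]
  · simp [h2, neg_add_eq_sub]

theorem rowBlock_mul_positionCol (hdet : IsUnit (Ψᵀ * A * Ψ).det)
    (hid : Φ * Φᵀ + Ψ * Ψᵀ = 1) :
    Φᵀ * A * Φ * Φᵀ - Φᵀ * A * Ψ * (Ψᵀ * A * Ψ)⁻¹ * (Ψᵀ * A * Φ) * Φᵀ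
      + rowBlock A Γ Φ Ψ * positionCol A Ψ = Φᵀ * A := by
  have hid' : Φ * Φᵀ = 1 - Ψ * Ψᵀ := eq_sub_of_add_eq hid
  have h1 : Φᵀ * A * Ψ * (Ψᵀ * A * Ψ)⁻¹ * (Ψᵀ * A * Φ) * Φᵀ
      = Φᵀ * A * Ψ * ((Ψᵀ * A * Ψ)⁻¹ * (Ψᵀ * A)) - Φᵀ * A * Ψ * Ψᵀ := by
    calc _ = Φᵀ * A * Ψ * ((Ψᵀ * A * Ψ)⁻¹ * (Ψᵀ * A * (Φ * Φᵀ))) := by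
          simp only [Matrix.mul_assoc]
      _ = Φᵀ * A * Ψ * ((Ψᵀ * A * Ψ)⁻¹ * (Ψᵀ * A))
          - Φᵀ * A * Ψ * ((Ψᵀ * A * Ψ)⁻¹ * (Ψᵀ * A * Ψ) * Ψᵀ) := by
          rw [hid', Matrix.mul_sub, Matrix.mul_sub, Matrix.mul_sub]
          simp only [Matrix.mul_assoc, Matrix.mul_one]
      _ = _ := by rw [Matrix.nonsing_inv_mul _ hdet, Matrix.one_mul]
  rw [h1, rowBlock, positionCol, Matrix.fromCols_mul_fromRows, Matrix.mul_assoc (Φᵀ * A), hid',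
    Matrix.mul_sub, Matrix.mul_zero, ← Matrix.mul_assoc]
  simp

theorem rowBlock_mul_velocityCol (hid : Φ * Φᵀ + Ψ * Ψᵀ = 1) :
    Φᵀ * Γ * Φ * Φᵀ + rowBlock A Γ Φ Ψ * velocityCol Ψ = Φᵀ * Γ := by
  rw [rowBlock, velocityCol, Matrix.fromCols_mul_fromRows, Matrix.mul_zero, zero_add,
    Matrix.mul_assoc _ Φ, Matrix.mul_assoc _ Ψ, ← Matrix.mul_add, hid, Matrix.mul_one]

theorem expG_eq (t : ℝ) : expG A Γ Ψ t = NormedSpace.exp (t • -G A Γ Ψ) := by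
  rw [expG, smul_neg]

theorem memoryKernel_eq (hA : Aᵀ = A) (hΓ : Γᵀ = Γ) (t : ℝ) :
    memoryKernel A Γ Φ Ψ t = rowBlock A Γ Φ Ψ * NormedSpace.exp (-(t • G A Γ Ψ))
      * kernelSign A Ψ * (rowBlock A Γ Φ Ψ)ᵀ := by
  rw [transpose_rowBlock hA hΓ, memoryKernel, expG, kernelSign]

/-- The unresolved state `(ξ̂, η)` in terms of the full position and velocity. -/
theorem unresolved_state_eq (hΦΨ : Φᵀ * Ψ = 0) (hΨ : Ψᵀ * Ψ = 1)
    (hdet : IsUnit (Ψᵀ * A * Ψ).det) (q p : Fin m → ℝ) (ξ η : Fin k → ℝ) :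
    Sum.elim (ξ + ((Ψᵀ * A * Ψ)⁻¹ * (Ψᵀ * A * Φ)) *ᵥ q) η
      = positionCol A Ψ *ᵥ (Φ *ᵥ q + Ψ *ᵥ ξ) + velocityCol Ψ *ᵥ (Φ *ᵥ p + Ψ *ᵥ η) := by
  have hΨΦ : Ψᵀ * Φ = 0 := by simpa using congrArg Matrix.transpose hΦΨ
  rw [positionCol, velocityCol, Matrix.fromRows_mulVec, Matrix.fromRows_mulVec]
  ext (i | i)
  · have h := Matrix.nonsing_inv_mul _ hdet
    simp only [Matrix.mul_assoc] at h
    simp only [Sum.elim_inl, Pi.add_apply, Matrix.mulVec_add, Matrix.mulVec_mulVec,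
      Matrix.zero_mul, Matrix.zero_mulVec, Pi.zero_apply, add_zero, Matrix.mul_assoc, h,
      Matrix.one_mulVec]
    ring
  · simp [Matrix.mulVec_add, Matrix.mulVec_mulVec, hΨ, hΨΦ]

end BlockAlgebra

/-! ### The dynamics along a single path -/

section Paths

variable {n m k : ℕ} {A Γ : Matrix (Fin n) (Fin n) ℝ}
  {Φ : Matrix (Fin n) (Fin m) ℝ} {Ψ : Matrix (Fin n) (Fin k) ℝ}

theorem coloredNoise_congr {w w' : ℝ → Fin n → ℝ} (h : ∀ s, 0 ≤ s → w s = w' s)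
    (q₀ : Fin m → ℝ) (ξ₀ η₀ : Fin k → ℝ) {t : ℝ} (ht : 0 ≤ t) :
    coloredNoise A Γ Φ Ψ w q₀ ξ₀ η₀ t = coloredNoise A Γ Φ Ψ w' q₀ ξ₀ η₀ t := by
  have e : ∫ s in (0 : ℝ)..t, deriv (fun r => expG A Γ Ψ (t - r) *ᵥ
        Sum.elim (0 : Fin k → ℝ) (Ψᵀ *ᵥ w s)) s
      = ∫ s in (0 : ℝ)..t, deriv (fun r => expG A Γ Ψ (t - r) *ᵥ
        Sum.elim (0 : Fin k → ℝ) (Ψᵀ *ᵥ w' s)) s :=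
    intervalIntegral.integral_congr fun s hs => by
      rw [uIcc_of_le ht] at hs
      simp only [h s hs.1]
  simp only [coloredNoise, wienerIntegral, e, h t ht, h 0 le_rfl]

theorem noisePrimitive_congr {w w' : ℝ → Fin n → ℝ} (h : ∀ s, 0 ≤ s → w s = w' s)
    (q₀ : Fin m → ℝ) (ξ₀ η₀ : Fin k → ℝ) {t : ℝ} (ht : 0 ≤ t) :
    noisePrimitive A Γ Φ Ψ w q₀ ξ₀ η₀ t = noisePrimitive A Γ Φ Ψ w' q₀ ξ₀ η₀ t := by
  rw [noisePrimitive, noisePrimitive, h t ht]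
  congr 1
  refine intervalIntegral.integral_congr fun s hs => ?_
  rw [uIcc_of_le ht] at hs
  exact coloredNoise_congr h q₀ ξ₀ η₀ hs.1

/-- `V` is the regular part of the orthogonal dynamics driven by the path `w`: the unresolved state
that starts from `z₀` and ignores the resolved velocity is `V + (0, Ψᵀ w)`. -/
structure IsOrthogonalDynamics (A Γ : Matrix (Fin n) (Fin n) ℝ) (Ψ : Matrix (Fin n) (Fin k) ℝ)
    (w : ℝ → Fin n → ℝ) (z₀ : Fin k ⊕ Fin k → ℝ) (V : ℝ → Fin k ⊕ Fin k → ℝ) : Prop where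
  init : V 0 = z₀
  hasDerivAt : ∀ t, HasDerivAt V (-G A Γ Ψ *ᵥ V t + -(G A Γ Ψ *ᵥ (velocityCol Ψ *ᵥ w t))) t

theorem IsOrthogonalDynamics.continuous {w : ℝ → Fin n → ℝ} {z₀ : Fin k ⊕ Fin k → ℝ}
    {V : ℝ → Fin k ⊕ Fin k → ℝ} (h : IsOrthogonalDynamics A Γ Ψ w z₀ V) : Continuous V :=
  continuous_iff_continuousAt.2 fun t => (h.hasDerivAt t).continuousAt

theorem exists_isOrthogonalDynamics {w : ℝ → Fin n → ℝ} (hw : Continuous w)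
    (z₀ : Fin k ⊕ Fin k → ℝ) : ∃ V, IsOrthogonalDynamics A Γ Ψ w z₀ V := by
  obtain ⟨V, h0, hV⟩ := exists_solution (-G A Γ Ψ)
    (b := fun t => -(G A Γ Ψ *ᵥ (velocityCol Ψ *ᵥ w t))) (by fun_prop) 0 z₀
  exact ⟨V, h0, hV⟩

/-- The coloured noise is the observation `-[A₁₂, Γ₁₂]` of the orthogonal dynamics. -/
theorem coloredNoise_eq {w : ℝ → Fin n → ℝ} (hw : Continuous w) (hw0 : w 0 = 0)
    (q₀ : Fin m → ℝ) (ξ₀ η₀ : Fin k → ℝ) {V : ℝ → Fin k ⊕ Fin k → ℝ}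
    (hV : IsOrthogonalDynamics A Γ Ψ w
      (Sum.elim (ξ₀ + ((Ψᵀ * A * Ψ)⁻¹ * (Ψᵀ * A * Φ)) *ᵥ q₀) η₀) V) (t : ℝ) :
    coloredNoise A Γ Φ Ψ w q₀ ξ₀ η₀ t
      = -(rowBlock A Γ Φ Ψ *ᵥ (V t + velocityCol Ψ *ᵥ w t)) := by
  have hcol : ∀ y : Fin n → ℝ, Sum.elim (0 : Fin k → ℝ) (Ψᵀ *ᵥ y) = velocityCol Ψ *ᵥ y :=
    fun y => by rw [velocityCol, Matrix.fromRows_mulVec, Matrix.zero_mulVec]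
  have hder : ∀ (y : Fin k ⊕ Fin k → ℝ) (s : ℝ),
      deriv (fun r => NormedSpace.exp ((t - r) • -G A Γ Ψ) *ᵥ y) s
        = -(NormedSpace.exp ((t - s) • -G A Γ Ψ) *ᵥ (-G A Γ Ψ *ᵥ y)) := fun y s => by
    have h1 := hasDerivAt_exp_smul_mulVec (-G A Γ Ψ) (hasDerivAt_const (t - s) y)
    rw [add_zero] at h1
    exact (HasDerivAt.comp_const_sub t s h1).deriv
  have hduh := duhamel (-G A Γ Ψ) (b := fun t => -(G A Γ Ψ *ᵥ (velocityCol Ψ *ᵥ w t)))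
    (by fun_prop) hV.hasDerivAt 0 t
  rw [sub_zero, hV.init] at hduh
  simp only [coloredNoise, wienerIntegral, expG_eq, hcol, hder, hw0, hduh, Sum.elim_zero_zero,
    sub_self, zero_smul,
    NormedSpace.exp_zero, Matrix.one_mulVec, Matrix.mulVec_zero, sub_zero, Matrix.neg_mulVec,
    Matrix.mulVec_neg, intervalIntegral.integral_neg, Matrix.mulVec_add, Matrix.mulVec_sub, neg_neg]
  abel

theorem noisePrimitive_eq {w : ℝ → Fin n → ℝ} (hw : Continuous w) (hw0 : w 0 = 0)
    (q₀ : Fin m → ℝ) (ξ₀ η₀ : Fin k → ℝ) {V : ℝ → Fin k ⊕ Fin k → ℝ}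
    (hV : IsOrthogonalDynamics A Γ Ψ w
      (Sum.elim (ξ₀ + ((Ψᵀ * A * Ψ)⁻¹ * (Ψᵀ * A * Φ)) *ᵥ q₀) η₀) V) (t : ℝ) :
    noisePrimitive A Γ Φ Ψ w q₀ ξ₀ η₀ t = Φᵀ *ᵥ w t
      - ∫ s in (0 : ℝ)..t, rowBlock A Γ Φ Ψ *ᵥ (V s + velocityCol Ψ *ᵥ w s) := by
  simp only [noisePrimitive, coloredNoise_eq hw hw0 q₀ ξ₀ η₀ hV, intervalIntegral.integral_neg,
    sub_eq_add_neg]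

/-- Along a path of the full dynamics, the unresolved state is the sum of the orthogonal dynamics
and of the response to the resolved velocity, which carries the memory kernel. -/
theorem memory_eq (hA : Aᵀ = A) (hΓ : Γᵀ = Γ) (hdet : IsUnit (Ψᵀ * A * Ψ).det)
    (hid : Φ * Φᵀ + Ψ * Ψᵀ = 1) {x v w : ℝ → Fin n → ℝ} (hx : Continuous x) (hv : Continuous v)
    (hw : Continuous w) (hw0 : w 0 = 0) (hx' : ∀ t, 0 < t → HasDerivAt x (v t) t)
    (hv' : ∀ t, 0 < t → HasDerivAt (fun s => v s - w s) (-(A *ᵥ x t) - Γ *ᵥ v t) t)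
    {V : ℝ → Fin k ⊕ Fin k → ℝ} (hV : IsOrthogonalDynamics A Γ Ψ w
      (positionCol A Ψ *ᵥ x 0 + velocityCol Ψ *ᵥ v 0) V) {t : ℝ} (ht : 0 ≤ t) :
    rowBlock A Γ Φ Ψ *ᵥ (positionCol A Ψ *ᵥ x t + velocityCol Ψ *ᵥ v t)
      = rowBlock A Γ Φ Ψ *ᵥ (V t + velocityCol Ψ *ᵥ w t)
        + ∫ s in (0 : ℝ)..t, memoryKernel A Γ Φ Ψ (t - s) *ᵥ (Φᵀ *ᵥ v s) := by
  have hVc := hV.continuous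
  set y : ℝ → Fin k ⊕ Fin k → ℝ := fun t =>
    positionCol A Ψ *ᵥ x t + velocityCol Ψ *ᵥ (v t - w t) - V t with hy
  have hyc : Continuous y := by fun_prop
  have hb : Continuous fun t => (kernelSign A Ψ * colBlock A Γ Φ Ψ * Φᵀ) *ᵥ v t := by fun_prop
  have hy' : ∀ t, 0 < t → HasDerivAt y
      (-G A Γ Ψ *ᵥ y t + (kernelSign A Ψ * colBlock A Γ Φ Ψ * Φᵀ) *ᵥ v t) t := fun t ht => by
    refine (((hasDerivAt_mulVec _ (hx' t ht)).add (hasDerivAt_mulVec _ (hv' t ht))).sub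
      (hV.hasDerivAt t)).congr_deriv ?_
    rw [← positionCol_sub (Γ := Γ) hdet hid]
    simp only [hy, Matrix.mulVec_add, Matrix.mulVec_sub, Matrix.mulVec_neg, Matrix.neg_mulVec,
      Matrix.add_mulVec, Matrix.sub_mulVec, Matrix.mulVec_mulVec, Matrix.neg_mul, G_mul_positionCol hdet]
    abel
  have hduh := duhamel_of_continuousOn (-G A Γ Ψ) hb (t₀ := 0) (t := t) hyc.continuousOn
    fun s hs => hy' s (by rw [min_eq_left ht] at hs; exact hs.1)
  have hy0 : y 0 = 0 := by simp [hy, hV.init, hw0]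
  rw [hy0, Matrix.mulVec_zero, zero_add] at hduh
  have hyt : positionCol A Ψ *ᵥ x t + velocityCol Ψ *ᵥ v t
      = V t + velocityCol Ψ *ᵥ w t + y t := by
    simp only [hy, Matrix.mulVec_sub]; abel
  rw [hyt, Matrix.mulVec_add, hduh, mulVec_intervalIntegral _
    (continuous_exp_smul_mulVec _ (by fun_prop) hb)]
  congr 1
  refine intervalIntegral.integral_congr fun s _ => ?_
  simp only [memoryKernel_eq hA hΓ, transpose_rowBlock hA hΓ, Matrix.mulVec_mulVec,
    Matrix.mul_assoc, smul_neg]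

/-- Projection of the full force onto the resolved subspace. -/
theorem effectiveForce_eq (hdet : IsUnit (Ψᵀ * A * Ψ).det) (hid : Φ * Φᵀ + Ψ * Ψᵀ = 1)
    (x v : Fin n → ℝ) :
    Φᵀ *ᵥ (-(A *ᵥ x) - Γ *ᵥ v) = effectiveForce A Φ Ψ (Φᵀ *ᵥ x) - (Φᵀ * Γ * Φ) *ᵥ (Φᵀ *ᵥ v)
      - rowBlock A Γ Φ Ψ *ᵥ (positionCol A Ψ *ᵥ x + velocityCol Ψ *ᵥ v) := by
  have h1 := congrArg (· *ᵥ x) (rowBlock_mul_positionCol (Γ := Γ) hdet hid)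
  have h2 := congrArg (· *ᵥ v) (rowBlock_mul_velocityCol (A := A) (Γ := Γ) hid)
  simp only [effectiveForce, Matrix.mulVec_sub, Matrix.mulVec_neg, Matrix.mulVec_add,
    Matrix.mulVec_mulVec, Matrix.add_mulVec, Matrix.sub_mulVec] at h1 h2 ⊢
  rw [← h1, ← h2]
  abel

/-- The generalized Langevin equation along a single path of the full dynamics. -/
theorem generalized_langevin_path (hA : Aᵀ = A) (hΓ : Γᵀ = Γ) (hdet : IsUnit (Ψᵀ * A * Ψ).det)
    (hid : Φ * Φᵀ + Ψ * Ψᵀ = 1) {x v w : ℝ → Fin n → ℝ} (hx : ContinuousOn x (Ici 0))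
    (hv : ContinuousOn v (Ici 0)) (hw : ContinuousOn w (Ici 0)) (hw0 : w 0 = 0)
    (hx' : ∀ t, 0 ≤ t → x t = x 0 + ∫ s in (0 : ℝ)..t, v s)
    (hv' : ∀ t, 0 ≤ t →
      v t = v 0 + (∫ s in (0 : ℝ)..t, (-(A *ᵥ x s) - Γ *ᵥ v s)) + w t)
    {q₀ : Fin m → ℝ} {ξ₀ η₀ : Fin k → ℝ}
    (hinit : Sum.elim (ξ₀ + ((Ψᵀ * A * Ψ)⁻¹ * (Ψᵀ * A * Φ)) *ᵥ q₀) η₀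
      = positionCol A Ψ *ᵥ x 0 + velocityCol Ψ *ᵥ v 0) {t : ℝ} (ht : 0 ≤ t) :
    HasDerivWithinAt (fun s => Φᵀ *ᵥ x s) (Φᵀ *ᵥ v t) (Ici 0) t ∧
    Φᵀ *ᵥ v t = Φᵀ *ᵥ v 0 + (∫ s in (0 : ℝ)..t,
        (effectiveForce A Φ Ψ (Φᵀ *ᵥ x s) - (Φᵀ * Γ * Φ) *ᵥ (Φᵀ *ᵥ v s)
          - ∫ τ in (0 : ℝ)..s, memoryKernel A Γ Φ Ψ (s - τ) *ᵥ (Φᵀ *ᵥ v τ)))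
      + noisePrimitive A Γ Φ Ψ w q₀ ξ₀ η₀ t := by
  -- constant extensions to negative times
  set X : ℝ → Fin n → ℝ := fun t => x (max t 0) with hXdef
  set U : ℝ → Fin n → ℝ := fun t => v (max t 0) with hUdef
  set Y : ℝ → Fin n → ℝ := fun t => w (max t 0) with hYdef
  have hXc : Continuous X := continuous_comp_max_zero hx
  have hUc : Continuous U := continuous_comp_max_zero hv
  have hYc : Continuous Y := continuous_comp_max_zero hw
  have eX : ∀ s, 0 ≤ s → x s = X s := fun s hs => by simp only [hXdef, max_eq_left hs]
  have eU : ∀ s, 0 ≤ s → v s = U s := fun s hs => by simp only [hUdef, max_eq_left hs]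
  have eY : ∀ s, 0 ≤ s → w s = Y s := fun s hs => by simp only [hYdef, max_eq_left hs]
  have hforce : Continuous fun s => -(A *ᵥ X s) - Γ *ᵥ U s := by fun_prop
  have hXint : ∀ t, 0 ≤ t → X t = X 0 + ∫ s in (0 : ℝ)..t, U s := fun t ht => by
    rw [← eX t ht, hx' t ht, eX 0 le_rfl]
    congr 1
    refine intervalIntegral.integral_congr fun s hs => ?_
    rw [uIcc_of_le ht] at hs
    exact eU s hs.1
  have hUint : ∀ t, 0 ≤ t → U t - Y t
      = U 0 + ∫ s in (0 : ℝ)..t, (-(A *ᵥ X s) - Γ *ᵥ U s) := fun t ht => by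
    rw [← eU t ht, ← eY t ht, hv' t ht, eU 0 le_rfl, add_sub_cancel_right]
    congr 1
    refine intervalIntegral.integral_congr fun s hs => ?_
    rw [uIcc_of_le ht] at hs
    simp only [eX s hs.1, eU s hs.1]
  have hFTC : ∀ {b : ℝ → Fin n → ℝ} (c : Fin n → ℝ), Continuous b → ∀ t,
      HasDerivAt (fun t => c + ∫ s in (0 : ℝ)..t, b s) (b t) t := fun c hb t =>
    (intervalIntegral.integral_hasDerivAt_right (hb.intervalIntegrable _ _)
      (hb.stronglyMeasurableAtFilter _ _) hb.continuousAt).const_add _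
  have hX' : ∀ t, 0 < t → HasDerivAt X (U t) t := fun t ht =>
    (hFTC (X 0) hUc t).congr_of_eventuallyEq
      ((eventually_gt_nhds ht).mono fun s hs => hXint s (le_of_lt hs))
  have hU' : ∀ t, 0 < t → HasDerivAt (fun s => U s - Y s) (-(A *ᵥ X t) - Γ *ᵥ U t) t :=
    fun t ht => (hFTC (U 0) hforce t).congr_of_eventuallyEq
      ((eventually_gt_nhds ht).mono fun s hs => hUint s (le_of_lt hs))
  have hY0 : Y 0 = 0 := by rw [← eY 0 le_rfl, hw0]
  obtain ⟨V, hV⟩ := exists_isOrthogonalDynamics (A := A) (Γ := Γ) (Ψ := Ψ) hYc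
    (positionCol A Ψ *ᵥ X 0 + velocityCol Ψ *ᵥ U 0)
  have hVc := hV.continuous
  rw [eX 0 le_rfl, eU 0 le_rfl] at hinit
  refine ⟨?_, ?_⟩
  · rw [eU t ht]
    refine (hasDerivAt_mulVec Φᵀ (hFTC (X 0) hUc t)).hasDerivWithinAt.congr (fun s hs => ?_) ?_
    · rw [eX s hs, hXint s hs]
    · rw [eX t ht, hXint t ht]
  · have hU : U t = U 0 + (∫ s in (0 : ℝ)..t, (-(A *ᵥ X s) - Γ *ᵥ U s)) + Y t := by
      rw [← hUint t ht, sub_add_cancel]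
    have hnoise : Continuous fun s => rowBlock A Γ Φ Ψ *ᵥ (V s + velocityCol Ψ *ᵥ Y s) := by
      fun_prop
    rw [eU t ht, eU 0 le_rfl, noisePrimitive_congr eY q₀ ξ₀ η₀ ht,
      noisePrimitive_eq hYc hY0 q₀ ξ₀ η₀ (hinit ▸ hV)]
    conv_lhs => rw [hU, Matrix.mulVec_add, Matrix.mulVec_add, mulVec_intervalIntegral _ hforce]
    have key : ∀ s ∈ uIcc 0 t, effectiveForce A Φ Ψ (Φᵀ *ᵥ x s) - (Φᵀ * Γ * Φ) *ᵥ (Φᵀ *ᵥ v s)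
          - (∫ τ in (0 : ℝ)..s, memoryKernel A Γ Φ Ψ (s - τ) *ᵥ (Φᵀ *ᵥ v τ))
        = Φᵀ *ᵥ (-(A *ᵥ X s) - Γ *ᵥ U s)
          + rowBlock A Γ Φ Ψ *ᵥ (V s + velocityCol Ψ *ᵥ Y s) := fun s hs => by
      rw [uIcc_of_le ht] at hs
      have hmem : (∫ τ in (0 : ℝ)..s, memoryKernel A Γ Φ Ψ (s - τ) *ᵥ (Φᵀ *ᵥ v τ))
          = ∫ τ in (0 : ℝ)..s, memoryKernel A Γ Φ Ψ (s - τ) *ᵥ (Φᵀ *ᵥ U τ) :=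
        intervalIntegral.integral_congr fun τ hτ => by
          rw [uIcc_of_le hs.1] at hτ
          simp only [eU τ hτ.1]
      rw [hmem, eX s hs.1, eU s hs.1, effectiveForce_eq hdet hid,
        memory_eq hA hΓ hdet hid hXc hUc hYc hY0 hX' hU' hV hs.1]
      abel
    rw [intervalIntegral.integral_congr key, intervalIntegral.integral_add
      (Continuous.intervalIntegrable (by fun_prop) _ _) (hnoise.intervalIntegrable _ _)]
    abel

theorem setIntegral_Ioi_eq_intervalIntegral {f : ℝ → ℝ} {M : ℝ} (hM : 0 ≤ M)
    (hf : ∀ t, M < t → f t = 0) : ∫ t in Ioi (0 : ℝ), f t = ∫ t in (0 : ℝ)..M, f t := by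
  rw [intervalIntegral.integral_of_le hM]
  refine setIntegral_eq_of_subset_of_forall_sdiff_eq_zero measurableSet_Ioi
    Ioc_subset_Ioi_self fun t ht => hf t ?_
  by_contra h
  exact ht.2 ⟨ht.1, not_lt.1 h⟩

/-- Tested against `φ`, the reduced noise is a linear functional of the driving path and of the
initial data: transposing the orthogonal dynamics replaces it by the adjoint state `Y`. -/
theorem distribDeriv_noisePrimitive {w : ℝ → Fin n → ℝ} (hwc : ContinuousOn w (Ici 0))
    (hw0 : w 0 = 0) {q₀ : Fin m → ℝ} {ξ₀ η₀ : Fin k → ℝ} {z₀ : Fin k ⊕ Fin k → ℝ}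
    (hinit : Sum.elim (ξ₀ + ((Ψᵀ * A * Ψ)⁻¹ * (Ψᵀ * A * Φ)) *ᵥ q₀) η₀ = z₀)
    (φ : TestFun m) {Y : ℝ → Fin k ⊕ Fin k → ℝ}
    (hY : IsAdjointState (G A Γ Ψ) (rowBlock A Γ Φ Ψ) φ.1 Y) {M : ℝ} (hM : 0 ≤ M)
    (hφ0 : φ.1 0 = 0) (hφM : ∀ t, M ≤ t → φ.1 t = 0) (hYM : Y M = 0) :
    distribDeriv (fun t => noisePrimitive A Γ Φ Ψ w q₀ ξ₀ η₀ t) φ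
      = -(Y 0 ⬝ᵥ z₀) - ∫ t in (0 : ℝ)..M, (Φ *ᵥ deriv φ.1 t
          - (velocityCol Ψ)ᵀ *ᵥ ((G A Γ Ψ)ᵀ *ᵥ Y t - (rowBlock A Γ Φ Ψ)ᵀ *ᵥ φ.1 t)) ⬝ᵥ w t := by
  set W : ℝ → Fin n → ℝ := fun t => w (max t 0) with hWdef
  have hWc : Continuous W := continuous_comp_max_zero hwc
  have eW : ∀ s, 0 ≤ s → w s = W s := fun s hs => by simp only [hWdef, max_eq_left hs]
  have hW0 : W 0 = 0 := by rw [← eW 0 le_rfl, hw0]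
  obtain ⟨V, hV⟩ := exists_isOrthogonalDynamics (A := A) (Γ := Γ) (Ψ := Ψ) hWc z₀
  have hVc := hV.continuous
  have hYc := hY.continuous
  have hφc : Continuous φ.1 := φ.2.1.continuous
  have hφ'c : Continuous (deriv φ.1) := φ.2.1.continuous_deriv (by simp)
  have hφ' : ∀ t, HasDerivAt φ.1 (deriv φ.1 t) t := fun t =>
    (φ.2.1.differentiable (by simp) t).hasDerivAt
  have hb : Continuous fun s => rowBlock A Γ Φ Ψ *ᵥ (V s + velocityCol Ψ *ᵥ W s) := by fun_prop
  set I : ℝ → Fin m → ℝ := fun t =>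
    ∫ s in (0 : ℝ)..t, rowBlock A Γ Φ Ψ *ᵥ (V s + velocityCol Ψ *ᵥ W s) with hI
  have hI' : ∀ t, HasDerivAt I (rowBlock A Γ Φ Ψ *ᵥ (V t + velocityCol Ψ *ᵥ W t)) t := fun t =>
    intervalIntegral.integral_hasDerivAt_right (hb.intervalIntegrable _ _)
      (hb.stronglyMeasurableAtFilter _ _) hb.continuousAt
  have hIc : Continuous I := continuous_iff_continuousAt.2 fun t => (hI' t).continuousAt
  have hderiv0 : ∀ t, M < t → deriv φ.1 t = 0 := fun t ht => by
    have : φ.1 =ᶠ[nhds t] fun _ => 0 :=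
      (eventually_gt_nhds ht).mono fun s hs => hφM s (le_of_lt hs)
    rw [this.deriv_eq, deriv_const]
  -- integrating this derivative performs both integrations by parts at once
  have hder : ∀ t, HasDerivAt (fun t => φ.1 t ⬝ᵥ I t + Y t ⬝ᵥ V t) _ t := fun t =>
    (hasDerivAt_dotProduct (hφ' t) (hI' t)).add
      (hasDerivAt_dotProduct (hY.hasDerivAt t) (hV.hasDerivAt t))
  have hFTC := intervalIntegral.integral_eq_sub_of_hasDerivAt (a := 0) (b := M)
    (fun t _ => hder t) (Continuous.intervalIntegrable (by fun_prop) _ _)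
  rw [hφM M le_rfl, hYM, hφ0, hV.init] at hFTC
  simp only [zero_dotProduct, add_zero, zero_add, zero_sub] at hFTC
  rw [distribDeriv, setIntegral_Ioi_eq_intervalIntegral hM fun t ht => by
    rw [hderiv0 t ht, zero_dotProduct], ← hFTC, ← intervalIntegral.integral_neg]
  have e1 : ∫ t in (0 : ℝ)..M, -(deriv φ.1 t ⬝ᵥ noisePrimitive A Γ Φ Ψ w q₀ ξ₀ η₀ t)
      = ∫ t in (0 : ℝ)..M, -(deriv φ.1 t ⬝ᵥ (Φᵀ *ᵥ W t - I t)) :=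
    intervalIntegral.integral_congr fun t ht => by
      rw [uIcc_of_le hM] at ht
      simp only [noisePrimitive_congr eW q₀ ξ₀ η₀ ht.1,
        noisePrimitive_eq hWc hW0 q₀ ξ₀ η₀ (hinit ▸ hV), hI]
  have e2 : ∫ t in (0 : ℝ)..M, (Φ *ᵥ deriv φ.1 t - (velocityCol Ψ)ᵀ *ᵥ
        ((G A Γ Ψ)ᵀ *ᵥ Y t - (rowBlock A Γ Φ Ψ)ᵀ *ᵥ φ.1 t)) ⬝ᵥ w t
      = ∫ t in (0 : ℝ)..M, (Φ *ᵥ deriv φ.1 t - (velocityCol Ψ)ᵀ *ᵥ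
        ((G A Γ Ψ)ᵀ *ᵥ Y t - (rowBlock A Γ Φ Ψ)ᵀ *ᵥ φ.1 t)) ⬝ᵥ W t :=
    intervalIntegral.integral_congr fun t ht => by
      rw [uIcc_of_le hM] at ht
      simp only [eW t ht.1]
  rw [e1, e2, ← intervalIntegral.integral_sub]
  · refine intervalIntegral.integral_congr fun t _ => ?_
    simp only [Matrix.mulVec_sub, Matrix.mulVec_add, Matrix.neg_mulVec,
      transpose_mulVec_dotProduct, mulVec_dotProduct Φ, dotProduct_sub,
      sub_dotProduct, dotProduct_add, dotProduct_neg, Matrix.mulVec_mulVec,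
      ← Matrix.transpose_mul]
    ring
  all_goals exact Continuous.intervalIntegrable (by fun_prop) _ _

end Paths

/-! ### The covariance form and the law of the reduced noise -/

section NoiseCovariance

variable {n m k : ℕ} {A Γ : Matrix (Fin n) (Fin n) ℝ}
  {Φ : Matrix (Fin n) (Fin m) ℝ} {Ψ : Matrix (Fin n) (Fin k) ℝ} {β : ℝ}

/-- The covariance form `2β Γ₁₁ δ(t - t') + β θ(|t - t'|)` evaluated at two test functions. -/
def noiseCov (A Γ : Matrix (Fin n) (Fin n) ℝ) (Φ : Matrix (Fin n) (Fin m) ℝ)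
    (Ψ : Matrix (Fin n) (Fin k) ℝ) (β : ℝ) (φ ψ : TestFun m) : ℝ :=
  2 * β * (∫ t in Ioi (0 : ℝ), φ.1 t ⬝ᵥ ((Φᵀ * Γ * Φ) *ᵥ ψ.1 t))
    + β * ∫ t in Ioi (0 : ℝ), ∫ t' in Ioi (0 : ℝ),
        φ.1 t ⬝ᵥ (memoryKernel A Γ Φ Ψ |t - t'| *ᵥ ψ.1 t')

theorem TestFun.eq_zero_of_nonpos (φ : TestFun m) {t : ℝ} (ht : t ≤ 0) : φ.1 t = 0 := by
  by_contra h
  exact absurd (φ.2.2.2 (subset_tsupport _ h)) (not_lt.2 ht)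

theorem TestFun.exists_eq_zero (φ : TestFun m) : ∃ M, ∀ t, M ≤ t → φ.1 t = 0 := by
  obtain ⟨M, hM⟩ := φ.2.2.1.isCompact.isBounded.subset_closedBall 0
  refine ⟨M + 1, fun t ht => ?_⟩
  by_contra h
  have h1 := hM (subset_tsupport _ h)
  rw [mem_closedBall_zero_iff, Real.norm_eq_abs, abs_le] at h1
  linarith

/-- The covariance form is stationary, since `θ` enters through `|t - t'|` only. -/
theorem noiseCov_shift (h : ℝ≥0) (φ ψ : TestFun m) :
    noiseCov A Γ Φ Ψ β (φ.shift h) (ψ.shift h) = noiseCov A Γ Φ Ψ β φ ψ := by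
  have hline : ∀ f : ℝ → ℝ, (∀ t, t ≤ 0 → f t = 0) → ∫ t in Ioi (0 : ℝ), f t = ∫ t, f t :=
    fun f hf => setIntegral_eq_integral_of_forall_compl_eq_zero fun t ht => hf t (not_lt.1 ht)
  -- reduction to integrals over the whole line, which are translation invariant
  have hcov : ∀ φ ψ : TestFun m, noiseCov A Γ Φ Ψ β φ ψ
      = 2 * β * (∫ t, φ.1 t ⬝ᵥ ((Φᵀ * Γ * Φ) *ᵥ ψ.1 t))
        + β * ∫ t, ∫ t', φ.1 t ⬝ᵥ (memoryKernel A Γ Φ Ψ |t - t'| *ᵥ ψ.1 t') := fun φ ψ => by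
    rw [noiseCov, hline _ fun t ht => by simp [φ.eq_zero_of_nonpos ht],
      hline _ fun t ht => by simp [φ.eq_zero_of_nonpos ht]]
    congr 2
    refine integral_congr_ae (.of_forall fun t => ?_)
    exact hline _ fun t' ht' => by simp [ψ.eq_zero_of_nonpos ht']
  rw [hcov, hcov]
  have e : ∀ χ : TestFun m, (χ.shift h).1 = fun t => χ.1 (t - h) := fun χ => rfl
  rw [e, e, integral_sub_right_eq_self (fun t => φ.1 t ⬝ᵥ ((Φᵀ * Γ * Φ) *ᵥ ψ.1 t)) (h : ℝ)]
  congr 2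
  rw [← integral_sub_right_eq_self
    (fun t => ∫ t', φ.1 t ⬝ᵥ (memoryKernel A Γ Φ Ψ |t - t'| *ᵥ ψ.1 t')) (h : ℝ)]
  refine integral_congr_ae (.of_forall fun t => ?_)
  simp only
  rw [← integral_sub_right_eq_self
    (fun t' => φ.1 (t - h) ⬝ᵥ (memoryKernel A Γ Φ Ψ |t - h - t'| *ᵥ ψ.1 t')) (h : ℝ)]
  simp only [sub_sub_sub_cancel_right]

theorem dotProduct_mulVec_comm {S : Matrix (Fin n) (Fin n) ℝ} (hS : Sᵀ = S) (u v : Fin n → ℝ) :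
    u ⬝ᵥ (S *ᵥ v) = v ⬝ᵥ (S *ᵥ u) := by
  rw [dotProduct_comm, mulVec_dotProduct, hS]

/-- The covariance form in terms of the adjoint states: the first summand is contributed by the
driving noise, the second one by the equilibrium initial data. -/
theorem noiseCov_eq (hA : Aᵀ = A) (hAdet : IsUnit A.det) (hΓ : Γᵀ = Γ)
    (hdet : IsUnit (Ψᵀ * A * Ψ).det) (hΨ : Ψᵀ * Ψ = 1) {φ ψ : TestFun m}
    {Y Z : ℝ → Fin k ⊕ Fin k → ℝ}
    (hY : IsAdjointState (G A Γ Ψ) (rowBlock A Γ Φ Ψ) φ.1 Y)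
    (hZ : IsAdjointState (G A Γ Ψ) (rowBlock A Γ Φ Ψ) ψ.1 Z) {M : ℝ} (hM : 0 ≤ M)
    (hφM : ∀ t, M ≤ t → φ.1 t = 0) (hψM : ∀ t, M ≤ t → ψ.1 t = 0) (hYM : Y M = 0)
    (hZM : Z M = 0) :
    noiseCov A Γ Φ Ψ β φ ψ
      = (∫ t in (0 : ℝ)..M, (Φ *ᵥ φ.1 t - (velocityCol Ψ)ᵀ *ᵥ Y t) ⬝ᵥ
          (((2 * β) • Γ) *ᵥ (Φ *ᵥ ψ.1 t - (velocityCol Ψ)ᵀ *ᵥ Z t)))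
        + β * (-((positionCol A Ψ)ᵀ *ᵥ Y 0) ⬝ᵥ (A⁻¹ *ᵥ -((positionCol A Ψ)ᵀ *ᵥ Z 0))
          + -((velocityCol Ψ)ᵀ *ᵥ Y 0) ⬝ᵥ -((velocityCol Ψ)ᵀ *ᵥ Z 0)) := by
  have hfd := fluctuation_dissipation (S := (2 : ℝ) • Γ) (by rw [Matrix.transpose_smul, hΓ])
    (transpose_stateCov (Ψ := Ψ) hA) (transpose_kernelSign hA) (G_lyapunov hA hΓ hdet)
    rowBlock_cross (G_symm hA hΓ hdet) φ.2.1.continuous ψ.2.1.continuous hY hZ hM hYM hZM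
  simp only [← memoryKernel_eq hA hΓ] at hfd
  have e0 : Y 0 ⬝ᵥ (stateCov A Ψ *ᵥ Z 0)
      = -((positionCol A Ψ)ᵀ *ᵥ Y 0) ⬝ᵥ (A⁻¹ *ᵥ -((positionCol A Ψ)ᵀ *ᵥ Z 0))
          + -((velocityCol Ψ)ᵀ *ᵥ Y 0) ⬝ᵥ -((velocityCol Ψ)ᵀ *ᵥ Z 0) := by
    rw [← stateCov_eq hA hAdet hdet hΨ]
    simp only [Matrix.mulVec_neg, neg_dotProduct, dotProduct_neg, neg_neg,
      transpose_mulVec_dotProduct, Matrix.mulVec_mulVec, Matrix.add_mulVec, dotProduct_add,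
      Matrix.mul_assoc]
  have e1 : ∫ t in Ioi (0 : ℝ), φ.1 t ⬝ᵥ ((Φᵀ * Γ * Φ) *ᵥ ψ.1 t)
      = ∫ t in (0 : ℝ)..M, φ.1 t ⬝ᵥ ((Φᵀ * Γ * Φ) *ᵥ ψ.1 t) :=
    setIntegral_Ioi_eq_intervalIntegral hM fun t ht => by simp [hφM t ht.le]
  have e2 : (∫ t in Ioi (0 : ℝ), ∫ t' in Ioi (0 : ℝ),
        φ.1 t ⬝ᵥ (memoryKernel A Γ Φ Ψ |t - t'| *ᵥ ψ.1 t'))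
      = ∫ t in (0 : ℝ)..M, ∫ t' in (0 : ℝ)..M,
        φ.1 t ⬝ᵥ (memoryKernel A Γ Φ Ψ |t - t'| *ᵥ ψ.1 t') := by
    rw [setIntegral_Ioi_eq_intervalIntegral hM fun t ht => by simp [hφM t ht.le]]
    refine intervalIntegral.integral_congr fun t _ => ?_
    exact setIntegral_Ioi_eq_intervalIntegral hM fun t' ht' => by simp [hψM t' ht'.le]
  rw [noiseCov, e1, e2, ← e0]
  simp only [Matrix.mul_smul, Matrix.smul_mul, Matrix.smul_mulVec, dotProduct_smul, smul_eq_mul,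
    intervalIntegral.integral_const_mul] at hfd ⊢
  linear_combination (-β) * hfd

end NoiseCovariance

section Noise

variable {Ω : Type*} [MeasurableSpace Ω] {P : Measure Ω} [IsProbabilityMeasure P] {n m k : ℕ}
  {A Γ : Matrix (Fin n) (Fin n) ℝ} {Φ : Matrix (Fin n) (Fin m) ℝ} {Ψ : Matrix (Fin n) (Fin k) ℝ}
  {β : ℝ} {W : ℝ → Ω → Fin n → ℝ}

/-- Every linear combination of the reduced noise, tested against finitely many functions, is
centred Gaussian, and its variance is the corresponding value of the covariance form. -/
theorem hasLaw_noise_combination (hA : A.PosDef) (hΓ : Γᵀ = Γ) (hΦΨ : Φᵀ * Ψ = 0)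
    (hΨ : Ψᵀ * Ψ = 1) (hβ : 0 < β) (hW : IsWienerProcess P ((2 * β) • Γ) W)
    {x₀ v₀ : Ω → Fin n → ℝ} {q₀ p₀ : Ω → Fin m → ℝ} {ξ₀ η₀ : Ω → Fin k → ℝ}
    (hx : ∀ ω, x₀ ω = Φ *ᵥ q₀ ω + Ψ *ᵥ ξ₀ ω) (hv : ∀ ω, v₀ ω = Φ *ᵥ p₀ ω + Ψ *ᵥ η₀ ω)
    (hlaw : HasLaw (fun ω => (x₀ ω, v₀ ω)) (gibbsMeasure A β) P)
    (hind : IndepFun (fun ω => (x₀ ω, v₀ ω)) (fun ω (t : ℝ≥0) => W t ω) P)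
    {J : Type*} [Fintype J] (φ : J → TestFun m) (c : J → ℝ) :
    0 ≤ ∑ i, ∑ j, c i * c j * noiseCov A Γ Φ Ψ β (φ i) (φ j) ∧
    HasLaw (fun ω => ∑ j, c j * distribDeriv (fun t =>
        noisePrimitive A Γ Φ Ψ (fun s => W s ω) (q₀ ω) (ξ₀ ω) (η₀ ω) t) (φ j))
      (gaussianReal 0 (∑ i, ∑ j, c i * c j * noiseCov A Γ Φ Ψ β (φ i) (φ j)).toNNReal) P := by
  have hAT : Aᵀ = A := by simpa [Matrix.IsHermitian] using hA.isHermitian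
  have hAdet : IsUnit A.det := (Matrix.isUnit_iff_isUnit_det _).1 hA.isUnit
  have hdet := isUnit_det_block hA hΨ
  have hY : ∀ j, ∃ Y, IsAdjointState (G A Γ Ψ) (rowBlock A Γ Φ Ψ) (φ j).1 Y := fun j =>
    (φ j).exists_eq_zero.elim fun M hM => exists_isAdjointState _ _ (φ j).2.1.continuous hM
  choose Y hY using hY
  choose M₁ hM₁ using fun j => (φ j).exists_eq_zero
  choose M₂ hM₂ using fun j => (hY j).vanish
  -- a time after which all test functions and all adjoint states vanish
  obtain ⟨M, hM⟩ := Finite.exists_le fun j => max (M₁ j) (M₂ j)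
  have hφM : ∀ j t, max M 0 ≤ t → (φ j).1 t = 0 := fun j t ht =>
    hM₁ j t ((le_max_left _ _).trans ((hM j).trans ((le_max_left _ _).trans ht)))
  have hYM : ∀ j, Y j (max M 0) = 0 := fun j =>
    hM₂ j _ ((le_max_right _ _).trans ((hM j).trans (le_max_left _ _)))
  have hM0 : 0 ≤ max M 0 := le_max_right _ _
  have hYc : ∀ j, Continuous (Y j) := fun j => (hY j).continuous
  have hφc : ∀ j, Continuous (φ j).1 := fun j => (φ j).2.1.continuous
  have hφ'c : ∀ j, Continuous (deriv (φ j).1) := fun j => (φ j).2.1.continuous_deriv (by simp)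
  have hφ' : ∀ j t, HasDerivAt (φ j).1 (deriv (φ j).1 t) t := fun j t =>
    ((φ j).2.1.differentiable (by simp) t).hasDerivAt
  refine hW.hasLaw_linear_combination hA hβ hlaw hind
    (g := fun j t => Φ *ᵥ (φ j).1 t - (velocityCol Ψ)ᵀ *ᵥ Y j t)
    (g' := fun j t => Φ *ᵥ deriv (φ j).1 t - (velocityCol Ψ)ᵀ *ᵥ
      ((G A Γ Ψ)ᵀ *ᵥ Y j t - (rowBlock A Γ Φ Ψ)ᵀ *ᵥ (φ j).1 t))
    (fun j t => (hasDerivAt_mulVec Φ (hφ' j t)).sub (hasDerivAt_mulVec _ ((hY j).hasDerivAt t)))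
    (fun j => ?_) hM0 (fun j => ?_)
    (fun j => -((positionCol A Ψ)ᵀ *ᵥ Y j 0)) (fun j => -((velocityCol Ψ)ᵀ *ᵥ Y j 0))
    (fun j => ?_)
    (fun i j => noiseCov_eq hAT hAdet hΓ hdet hΨ (hY i) (hY j) hM0 (hφM i) (hφM j) (hYM i)
      (hYM j)) c
  · have h1 := hYc j
    have h2 := hφc j
    have h3 := hφ'c j
    fun_prop
  · simp only [hφM j _ le_rfl, hYM j, Matrix.mulVec_zero, sub_zero]
  · filter_upwards [hW.continuous, hW.ae_zero] with ω h1 h2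
    rw [distribDeriv_noisePrimitive h1 h2
      (unresolved_state_eq hΦΨ hΨ hdet (q₀ ω) (p₀ ω) (ξ₀ ω) (η₀ ω)) (φ j) (hY j) hM0
      ((φ j).eq_zero_of_nonpos le_rfl) (hφM j) (hYM j), ← hx, ← hv]
    simp only [dotProduct_add, neg_dotProduct, transpose_mulVec_dotProduct]
    ring

theorem noiseCov_comm (hA : A.PosDef) (hΓ : Γᵀ = Γ) (hΨ : Ψᵀ * Ψ = 1) (φ ψ : TestFun m) :
    noiseCov A Γ Φ Ψ β φ ψ = noiseCov A Γ Φ Ψ β ψ φ := by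
  have hAT : Aᵀ = A := by simpa [Matrix.IsHermitian] using hA.isHermitian
  have hAdet : IsUnit A.det := (Matrix.isUnit_iff_isUnit_det _).1 hA.isUnit
  have hdet := isUnit_det_block hA hΨ
  obtain ⟨M₁, h₁⟩ := φ.exists_eq_zero
  obtain ⟨M₂, h₂⟩ := ψ.exists_eq_zero
  obtain ⟨Y, hY⟩ := exists_isAdjointState (G A Γ Ψ) (rowBlock A Γ Φ Ψ) φ.2.1.continuous h₁
  obtain ⟨Z, hZ⟩ := exists_isAdjointState (G A Γ Ψ) (rowBlock A Γ Φ Ψ) ψ.2.1.continuous h₂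
  obtain ⟨M₃, h₃⟩ := hY.vanish
  obtain ⟨M₄, h₄⟩ := hZ.vanish
  set M := max 0 (max (max M₁ M₂) (max M₃ M₄))
  have hM0 : 0 ≤ M := le_max_left _ _
  have hM1 : M₁ ≤ M := by simp [M]
  have hM2 : M₂ ≤ M := by simp [M]
  have hM3 : M₃ ≤ M := by simp [M]
  have hM4 : M₄ ≤ M := by simp [M]
  have hAi : (A⁻¹)ᵀ = A⁻¹ := by rw [Matrix.transpose_nonsing_inv, hAT]
  have hS : ((2 * β) • Γ)ᵀ = (2 * β) • Γ := by rw [Matrix.transpose_smul, hΓ]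
  rw [noiseCov_eq hAT hAdet hΓ hdet hΨ hY hZ hM0 (fun t ht => h₁ t (hM1.trans ht))
      (fun t ht => h₂ t (hM2.trans ht)) (h₃ M hM3) (h₄ M hM4),
    noiseCov_eq hAT hAdet hΓ hdet hΨ hZ hY hM0 (fun t ht => h₂ t (hM2.trans ht))
      (fun t ht => h₁ t (hM1.trans ht)) (h₄ M hM4) (h₃ M hM3)]
  simp only [dotProduct_mulVec_comm hS (Φ *ᵥ φ.1 _ - _), dotProduct_mulVec_comm hAi
    (-((positionCol A Ψ)ᵀ *ᵥ Y 0)), dotProduct_comm (-((velocityCol Ψ)ᵀ *ᵥ Y 0))]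

end Noise

end GLE

end

/-! ### The reduced dynamics -/

theorem mainTheorem1
    {Ω : Type*} [MeasurableSpace Ω] (P : Measure Ω) [IsProbabilityMeasure P]
    (n m k : ℕ) (hdim : m + k = n)
    (kB T : ℝ) (hkB : 0 < kB) (hT : 0 < T)
    (A Γ : Matrix (Fin n) (Fin n) ℝ) (hA : A.PosDef) (hΓ : Γ.PosSemidef)
    -- orthonormal bases of the subspace `Y` and of its orthogonal complement
    (Φ : Matrix (Fin n) (Fin m) ℝ) (Ψ : Matrix (Fin n) (Fin k) ℝ)
    (hΦΨ : Φᵀ * Ψ = 0) (hΦ : Φᵀ * Φ = 1) (hΨ : Ψᵀ * Ψ = 1)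
    -- the full model, driven by the white noise `f = dW/dt`, `⟨f(t) f(t')ᵀ⟩ = 2 k_B T Γ δ(t - t')`
    (W x v : ℝ → Ω → Fin n → ℝ)
    (hW : GLE.IsWienerProcess P ((2 * (kB * T)) • Γ) W)
    (hxv : GLE.IsLangevinSolution P A Γ W x v)
    -- its decomposition
    (q p : ℝ → Ω → Fin m → ℝ) (ξ η : ℝ → Ω → Fin k → ℝ)
    (hx : ∀ t, 0 ≤ t → ∀ ω, x t ω = Φ *ᵥ q t ω + Ψ *ᵥ ξ t ω)
    (hv : ∀ t, 0 ≤ t → ∀ ω, v t ω = Φ *ᵥ p t ω + Ψ *ᵥ η t ω)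
    -- the time integral of the noise `f̂`, and `f̂` itself as a generalized process
    (What : ℝ → Ω → Fin m → ℝ)
    (hWhat : ∀ t ω, What t ω =
      GLE.noisePrimitive A Γ Φ Ψ (fun s => W s ω) (q 0 ω) (ξ 0 ω) (η 0 ω) t)
    (fhat : GLE.TestFun m → Ω → ℝ)
    (hfhat : ∀ φ ω, fhat φ ω = GLE.distribDeriv (fun t => What t ω) φ) :
    -- the generalized Langevin equation, with its second line integrated in time
    (∀ᵐ ω ∂P, ∀ t, 0 ≤ t →
      HasDerivWithinAt (fun s => q s ω) (p t ω) (Ici 0) t ∧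
      p t ω = p 0 ω
        + (∫ s in (0 : ℝ)..t,
            (GLE.effectiveForce A Φ Ψ (q s ω) - (Φᵀ * Γ * Φ) *ᵥ p s ω
              - ∫ τ in (0 : ℝ)..s, GLE.memoryKernel A Γ Φ Ψ (s - τ) *ᵥ p τ ω))
        + What t ω) ∧
    -- with equilibrium initial data that are independent of the driving noise
    (HasLaw (fun ω => (x 0 ω, v 0 ω)) (GLE.gibbsMeasure A (kB * T)) P →
      IndepFun (fun ω => (x 0 ω, v 0 ω)) (fun ω (t : ℝ≥0) => W t ω) P →
      -- `f̂` is Gaussian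
      IsGaussianProcess fhat P ∧
      -- with mean zero
      (∀ φ, ∫ ω, fhat φ ω ∂P = 0) ∧
      -- and stationary
      (∀ (h : ℝ≥0) (r : ℕ) (φ : Fin r → GLE.TestFun m),
        IdentDistrib (fun ω i => fhat (φ i) ω) (fun ω i => fhat ((φ i).shift h) ω) P P) ∧
      -- with `⟨f̂(t) f̂(t')ᵀ⟩ = 2 k_B T Γ₁₁ δ(t - t') + k_B T θ(|t - t'|)`
      (∀ φ ψ : GLE.TestFun m,
        ∫ ω, fhat φ ω * fhat ψ ω ∂P =
          2 * (kB * T) * (∫ t in Ioi (0 : ℝ), φ.1 t ⬝ᵥ ((Φᵀ * Γ * Φ) *ᵥ ψ.1 t))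
          + kB * T * ∫ t in Ioi (0 : ℝ), ∫ t' in Ioi (0 : ℝ),
              φ.1 t ⬝ᵥ (GLE.memoryKernel A Γ Φ Ψ |t - t'| *ᵥ ψ.1 t'))) := by
  have hAT : Aᵀ = A := by simpa [Matrix.IsHermitian] using hA.isHermitian
  have hΓT : Γᵀ = Γ := by simpa [Matrix.IsHermitian] using hΓ.isHermitian
  have hdet := GLE.isUnit_det_block hA hΨ
  have hid := GLE.resolution_of_identity hdim hΦΨ hΦ hΨ
  have hβ : 0 < kB * T := mul_pos hkB hT
  have hproj : ∀ (a : Fin m → ℝ) (b : Fin k → ℝ), Φᵀ *ᵥ (Φ *ᵥ a + Ψ *ᵥ b) = a := fun a b => by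
    simp [Matrix.mulVec_add, Matrix.mulVec_mulVec, hΦ, hΦΨ]
  have hq : ∀ t, 0 ≤ t → ∀ ω, q t ω = Φᵀ *ᵥ x t ω := fun t ht ω => by rw [hx t ht, hproj]
  have hp : ∀ t, 0 ≤ t → ∀ ω, p t ω = Φᵀ *ᵥ v t ω := fun t ht ω => by rw [hv t ht, hproj]
  refine ⟨?_, fun hlaw hind => ?_⟩
  · filter_upwards [hxv.continuous_x, hxv.continuous_v, hW.continuous, hW.ae_zero, hxv.position,
      hxv.velocity] with ω hxc hvc hwc hw0 hx' hv' t ht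
    have hinit := GLE.unresolved_state_eq (A := A) hΦΨ hΨ hdet (q 0 ω) (p 0 ω) (ξ 0 ω) (η 0 ω)
    rw [← hx 0 le_rfl, ← hv 0 le_rfl] at hinit
    obtain ⟨h1, h2⟩ := GLE.generalized_langevin_path hAT hΓT hdet hid hxc hvc hwc hw0 hx' hv'
      hinit ht
    rw [hp t ht, hp 0 le_rfl, hWhat]
    refine ⟨h1.congr (fun s hs => hq s hs ω) (hq t ht ω), h2.trans ?_⟩
    congr 2
    refine intervalIntegral.integral_congr fun s hs => ?_
    rw [uIcc_of_le ht] at hs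
    simp only [hq s hs.1, hp s hs.1]
    congr 1
    refine intervalIntegral.integral_congr fun τ hτ => ?_
    rw [uIcc_of_le hs.1] at hτ
    simp only [hp τ hτ.1]
  · have hcomb : ∀ {J : Type} [Fintype J] (φ : J → GLE.TestFun m) (c : J → ℝ),
        0 ≤ ∑ i, ∑ j, c i * c j * GLE.noiseCov A Γ Φ Ψ (kB * T) (φ i) (φ j) ∧
        HasLaw (fun ω => ∑ j, c j * fhat (φ j) ω) (gaussianReal 0
          (∑ i, ∑ j, c i * c j * GLE.noiseCov A Γ Φ Ψ (kB * T) (φ i) (φ j)).toNNReal) P :=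
      fun φ c => by
        simp only [hfhat, hWhat]
        exact GLE.hasLaw_noise_combination hA hΓT hΦΨ hΨ hβ hW (hx 0 le_rfl) (hv 0 le_rfl)
          hlaw hind φ c
    have hsingle : ∀ φ, HasLaw (fhat φ)
        (gaussianReal 0 (GLE.noiseCov A Γ Φ Ψ (kB * T) φ φ).toNNReal) P := fun φ => by
      simpa using (hcomb (fun _ : Unit => φ) fun _ => 1).2
    have hm : ∀ φ, AEMeasurable (fhat φ) P := fun φ => (hsingle φ).aemeasurable
    refine ⟨⟨fun I => ?_⟩, fun φ => ?_, fun h r φ => ?_, fun φ ψ => ?_⟩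
    · exact GLE.hasGaussianLaw_of_linear_combinations (X := fun i : I => fhat i)
        (fun i => hm i) fun c => ⟨_, (hcomb (fun i : I => (i : GLE.TestFun m)) c).2⟩
    · rw [(hsingle φ).integral_eq, integral_id_gaussianReal]
    · refine GLE.identDistrib_of_linear_combinations (fun i => hm _) (fun i => hm _) fun c =>
        ⟨_, (hcomb φ c).2, ?_⟩
      simpa only [GLE.noiseCov_shift] using (hcomb (fun i => (φ i).shift h) c).2
    · -- polarization of the variance of `f̂(φ) + f̂(ψ)`
      change _ = GLE.noiseCov A Γ Φ Ψ (kB * T) φ ψ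
      have hsq : ∀ χ, ∫ ω, fhat χ ω ^ 2 ∂P = GLE.noiseCov A Γ Φ Ψ (kB * T) χ χ := fun χ => by
        rw [GLE.integral_sq_eq_of_hasLaw_gaussianReal (hsingle χ), Real.coe_toNNReal]
        simpa using (hcomb (fun _ : Unit => χ) fun _ => 1).1
      obtain ⟨h0, h1⟩ := hcomb ![φ, ψ] fun _ => 1
      have h2 := GLE.integral_sq_eq_of_hasLaw_gaussianReal h1
      rw [Real.coe_toNNReal _ h0] at h2
      simp only [Fin.sum_univ_two, one_mul, Matrix.cons_val_zero, Matrix.cons_val_one] at h2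
      have hL : ∀ χ, MemLp (fhat χ) 2 P := fun χ =>
        GLE.memLp_two_of_hasLaw_gaussianReal (hsingle χ)
      have hexp : ∀ ω, (fhat φ ω + fhat ψ ω) ^ 2
          = fhat φ ω ^ 2 + fhat ψ ω ^ 2 + 2 * (fhat φ ω * fhat ψ ω) := fun ω => by ring
      have hI : Integrable (fun ω => fhat φ ω ^ 2 + fhat ψ ω ^ 2) P :=
        (hL φ).integrable_sq.add (hL ψ).integrable_sq
      have hI' : Integrable (fun ω => 2 * (fhat φ ω * fhat ψ ω)) P :=
        ((hL φ).integrable_mul (hL ψ)).const_mul 2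
      rw [integral_congr_ae (.of_forall hexp), integral_add hI hI',
        integral_add (hL φ).integrable_sq (hL ψ).integrable_sq, integral_const_mul, hsq, hsq,
        GLE.noiseCov_comm hA hΓT hΨ ψ φ] at h2
      linarith
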